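/- Identify $\hat{\mathbb R}=\mathbb R\cup\{\infty\}=\partial\mathbb H$ with the unit circle by the Cayley transform, and let $|I|$ be the length of an arc $I$ measured on that circle. An orientation-preserving homeomorphism $h:\hat{\mathbb R}\to\hat{\mathbb R}$ is *quasisymmetric* if there is $M>0$ with $\frac1M\le\frac{|h(I)|}{|h(J)|}\le M$ for all adjacent (non-overlapping, non-degenerate) arcs $I,J$ with $|I|=|J|$. Let $\mathcal F$ be the Farey triangulation of $\mathbb H$: its edges are the geodesics joining $\frac ab$ and $\frac cd$ with $a,b,c,d\in\mathbb Z$, $|ad-bc|=1$ (where $\frac{\pm1}{0}=\infty$). For a homeomorphism $h$ of $\hat{\mathbb R}$, $h(\mathcal F)$ is the ideal triangulation whose edges join the $h$-images of the endpoints of the edges of $\mathcal F$. A *(simultaneous) flip* $\mathcal D$ on an ideal triangulation $\mathcal T$ is given by a (finite or infinite, possibly empty) set of edges of $\mathcal T$ such that the quadrilaterals formed by the two triangles of $\mathcal T$ adjacent to each of these edges have pairwise disjoint interiors; $\mathcal D(\mathcal T)$ is obtained by replacing each of these edges by the other diagonal of its quadrilateral and keeping all other edges. A *characteristic map* of an ideal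 triangulation $\mathcal T'$ is an orientation-preserving homeomorphism $g$ of $\hat{\mathbb R}$ with $g(\mathcal F)=\mathcal T'$. **Proposition.** Let $h:\hat{\mathbb R}\to\hat{\mathbb R}$ be quasisymmetric, let $\mathcal T=h(\mathcal F)$, and let $\mathcal D$ be a simultaneous flip on $\mathcal T$. Then $\mathcal D(\mathcal T)$ has a characteristic map, and every characteristic map of $\mathcal D(\mathcal T)$ is quasisymmetric. -/

import Mathlib

namespace IdealTri

/-- The boundary `ℝ ∪ {∞}` of the upper half-plane, with the topology of the one-point
compactification, i.e. of a circle. -/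
abbrev Bdry : Type := OnePoint ℝ

/-- The angle in `(-π, π]` of the point of the unit circle which corresponds to a boundary point
under the Cayley transform `x ↦ (1 + i x) / (1 - i x)`, `∞ ↦ -1`. -/
noncomputable def angle (x : Bdry) : ℝ :=
  x.elim Real.pi (fun t : ℝ => 2 * Real.arctan t)

/-- The three points are distinct and occur in the order `a, b, c` when the circle is traversed
in the positive direction (the direction of increasing reals). -/
def PosOrder (a b c : Bdry) : Prop :=
  (angle a < angle b ∧ angle b < angle c) ∨
  (angle b < angle c ∧ angle c < angle a) ∨
  (angle c < angle a ∧ angle a < angle b)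

/-- The length, measured on the unit circle, of the arc which runs from `a` to `b` in the positive
direction; it lies in `[0, 2π)`. -/
noncomputable def arcLength (a b : Bdry) : ℝ :=
  if angle a ≤ angle b then angle b - angle a else angle b - angle a + 2 * Real.pi

/-- Orientation preserving: the cyclic order of triples is preserved. -/
def OrientationPreserving (h : Bdry ≃ₜ Bdry) : Prop :=
  ∀ a b c : Bdry, PosOrder a b c → PosOrder (h a) (h b) (h c)

/-- Quasisymmetric: orientation preserving, and for all adjacent non-overlapping arcs
`I = [a, b]`, `J = [b, c]` with `|I| = |J|` one has `1 / M ≤ |h I| / |h J| ≤ M`. Two arcs of equal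
length do not overlap exactly when their length is at most `π`, and `h I`, `h J` are the positive
arcs `[h a, h b]`, `[h b, h c]`. -/
def Quasisymmetric (h : Bdry ≃ₜ Bdry) : Prop :=
  OrientationPreserving h ∧
    ∃ M : ℝ, 0 < M ∧ ∀ a b c : Bdry, a ≠ b → arcLength a b = arcLength b c →
      arcLength a b ≤ Real.pi →
        1 / M ≤ arcLength (h a) (h b) / arcLength (h b) (h c) ∧
          arcLength (h a) (h b) / arcLength (h b) (h c) ≤ M

/-- The boundary point `p / q`, with `p / 0 = ∞`. -/
noncomputable def frac (p q : ℤ) : Bdry :=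
  if q = 0 then OnePoint.infty else (((p : ℝ) / (q : ℝ) : ℝ) : Bdry)

/-- The edges of the Farey triangulation. A geodesic of the hyperbolic plane is recorded as the
unordered pair of its ideal endpoints, and an ideal triangulation as the set of its edges. -/
def farey : Set (Sym2 Bdry) :=
  {e | ∃ p q r s : ℤ, |p * s - q * r| = 1 ∧ e = s(frac p q, frac r s)}

/-- The image `h(T)` of a set of geodesics under a homeomorphism of the boundary. -/
def mapTri (h : Bdry ≃ₜ Bdry) (T : Set (Sym2 Bdry)) : Set (Sym2 Bdry) :=
  Sym2.map h '' T

/-- `a`, `b`, `c` are the vertices of a triangle of the triangulation `T`: its sides are edges. -/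
def IsTriangle (T : Set (Sym2 Bdry)) (a b c : Bdry) : Prop :=
  s(a, b) ∈ T ∧ s(b, c) ∈ T ∧ s(a, c) ∈ T

/-- `a`, `b`, `c`, `d`, in positive cyclic order, are the vertices of the quadrilateral formed by
the two triangles `a b c` and `a c d` of `T`, which lie on the two sides of the edge `a c`. -/
def IsQuad (T : Set (Sym2 Bdry)) (a b c d : Bdry) : Prop :=
  PosOrder a b c ∧ PosOrder a c d ∧ IsTriangle T a b c ∧ IsTriangle T a c d

/-- `S` is the set of edges which are switched by a simultaneous flip on `T`: each of them is the
diagonal of a quadrilateral formed by two triangles of `T`, and quadrilaterals of different edges of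
`S` have disjoint interiors, i.e. no triangle of `T` belongs to two of them (no triangle of `T` has
two sides in `S`; the quadrilaterals may share sides and vertices). -/
structure IsFlip (T S : Set (Sym2 Bdry)) : Prop where
  subset : S ⊆ T
  diagonal : ∀ e ∈ S, ∃ a b c d : Bdry, IsQuad T a b c d ∧ e = s(a, c)
  disjoint : ∀ a b c : Bdry, IsTriangle T a b c → ¬ (s(a, b) ∈ S ∧ s(b, c) ∈ S)

/-- The result of the flip: every edge of `S` is replaced by the other diagonal of its
quadrilateral; all other edges are kept. -/
def flip (T S : Set (Sym2 Bdry)) : Set (Sym2 Bdry) :=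
  (T \ S) ∪ {e | ∃ a b c d : Bdry, s(a, c) ∈ S ∧ IsQuad T a b c d ∧ e = s(b, d)}

/-- `g` is a characteristic map of `T`: an orientation preserving homeomorphism of the boundary
that carries the Farey triangulation onto `T`. (It is determined by `T` only up to the choice of
the image of one triangle.) -/
def IsCharacteristicMap (g : Bdry ≃ₜ Bdry) (T : Set (Sym2 Bdry)) : Prop :=
  OrientationPreserving g ∧ mapTri g farey = T

end IdealTri

/-! Pulling back by h reduces everything to the Farey triangulation F: the flipped triangulation is
the h-image of a flip F' of F, and its characteristic maps are the maps h ∘ f with f a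
characteristic map of F'. Since quasisymmetric maps compose (`Quasisymmetric.trans`), it remains to
study f.

Existence of f (`exists_characteristicMap_flip_farey`). An edge cuts off an interval of the extended
line, and the third vertex of the triangle behind it splits that interval in two. Thus F and F' give
two binary subdivision trees, and the nodes of each are exactly the rationals. Matching nodes with
the same address is an increasing bijection of the rationals, hence extends to the circle
(`exists_matching`); it carries edges to edges.

Quasisymmetry of f (`FareyBounded.quasisymmetric`). Measure a pair of rational points by the
determinant `intDet` of their primitive integral vectors. Farey edges have determinant 1, and
Ptolemy's identity gives 2 for the new diagonals, so f sends determinant 1 to determinant at most 2.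
This property (`FareyBounded`) is invariant under SL(2, ℤ) on both sides. Two adjacent arcs [a, b],
[b, c] of equal length, together with the antipode e of b, form a harmonic quadruple, that is, two
perpendicular geodesics meeting at a point z of the half-plane. An integral matrix moves z to height
at least √3/2, and another one makes f fix infinity. On scales t ≥ √3/2 such an f distorts distances
by bounded factors (`fareyBounded_two_sided`), so image cross ratios are bounded uniformly
(`crossBounded_of_fareyBounded`). Compactness of the set of antipodal pairs turns this into a bound
for arcs. -/

namespace IdealTri

/-! ### Homogeneous coordinates and the cyclic order. -/

/-- The first homogeneous coordinate of a boundary point. -/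
def vecX (x : Bdry) : ℝ := x.elim 1 id

/-- The second homogeneous coordinate of a boundary point. -/
def vecY (x : Bdry) : ℝ := x.elim 0 (fun _ => 1)

/-- The determinant of the homogeneous coordinate vectors of two boundary points. -/
def wedge (x y : Bdry) : ℝ := vecX x * vecY y - vecX y * vecY x

@[simp] lemma vecX_infty : vecX OnePoint.infty = 1 := rfl
@[simp] lemma vecY_infty : vecY OnePoint.infty = 0 := rfl
@[simp] lemma vecX_coe (t : ℝ) : vecX (t : Bdry) = t := rfl
@[simp] lemma vecY_coe (t : ℝ) : vecY (t : Bdry) = 1 := rfl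
@[simp] lemma wedge_coe_coe (s t : ℝ) : wedge (s : Bdry) t = s - t := by simp [wedge]
@[simp] lemma wedge_infty_coe (t : ℝ) : wedge OnePoint.infty (t : Bdry) = 1 := by simp [wedge]
@[simp] lemma wedge_coe_infty (t : ℝ) : wedge (t : Bdry) OnePoint.infty = -1 := by simp [wedge]
@[simp] lemma wedge_self (x : Bdry) : wedge x x = 0 := by simp [wedge]

lemma wedge_swap (x y : Bdry) : wedge y x = - wedge x y := by simp only [wedge]; ring

lemma wedge_eq_zero {x y : Bdry} : wedge x y = 0 ↔ x = y := by
  induction x using OnePoint.rec <;> induction y using OnePoint.rec <;>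
    simp [sub_eq_zero, OnePoint.coe_ne_infty, OnePoint.infty_ne_coe]

lemma wedge_plucker (a b c d : Bdry) :
    wedge a c * wedge b d = wedge a b * wedge c d + wedge a d * wedge b c := by
  simp only [wedge]; ring

@[simp] lemma angle_infty : angle OnePoint.infty = Real.pi := rfl
@[simp] lemma angle_coe (t : ℝ) : angle (t : Bdry) = 2 * Real.arctan t := rfl

lemma angle_coe_lt_coe {s t : ℝ} : angle (s : Bdry) < angle (t : Bdry) ↔ s < t := by
  simp [Real.arctan_strictMono.lt_iff_lt]

lemma angle_coe_lt_pi (t : ℝ) : angle (t : Bdry) < Real.pi := by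
  have := Real.arctan_lt_pi_div_two t
  rw [angle_coe]; linarith

lemma angle_le_pi (x : Bdry) : angle x ≤ Real.pi := by
  induction x using OnePoint.rec with
  | infty => simp
  | coe t => exact (angle_coe_lt_pi t).le

lemma neg_pi_lt_angle (x : Bdry) : -Real.pi < angle x := by
  induction x using OnePoint.rec with
  | infty => simp [Real.pi_pos]
  | coe t =>
    have := Real.neg_pi_div_two_lt_arctan t
    rw [angle_coe]; linarith

/-- Each point occurs twice in the product, so its sign does not depend on the choice of homogeneous
vectors, not even on their signs. This turns cyclic order into algebra. -/
lemma posOrder_iff_wedge (a b c : Bdry) :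
    PosOrder a b c ↔ 0 < wedge a b * wedge b c * wedge c a := by
  have key : ∀ r s t : ℝ, ((r < s ∧ s < t) ∨ (s < t ∧ t < r) ∨ (t < r ∧ r < s)) ↔
      0 < (r - s) * (s - t) * (t - r) := by
    intro r s t
    constructor
    · rintro (⟨h1, h2⟩ | ⟨h1, h2⟩ | ⟨h1, h2⟩)
      · nlinarith [mul_pos (mul_pos (sub_pos.2 h1) (sub_pos.2 h2)) (sub_pos.2 (h1.trans h2))]
      · nlinarith [mul_pos (mul_pos (sub_pos.2 h1) (sub_pos.2 h2)) (sub_pos.2 (h1.trans h2))]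
      · nlinarith [mul_pos (mul_pos (sub_pos.2 h1) (sub_pos.2 h2)) (sub_pos.2 (h1.trans h2))]
    · intro h
      by_contra hc
      push Not at hc
      obtain ⟨h1, h2, h3⟩ := hc
      rcases lt_trichotomy r s with hrs | rfl | hrs
      · have := h1 hrs
        rcases le_total r t with hrt | hrt
        · nlinarith [mul_nonneg (mul_nonneg (sub_nonneg.2 hrs.le) (sub_nonneg.2 this))
            (sub_nonneg.2 hrt)]
        · rcases hrt.lt_or_eq with hrt | rfl
          · exact absurd (h3 hrt) (not_le.2 hrs)
          · simp at h
      · simp at h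
      · rcases lt_or_ge s t with hst | hst
        · nlinarith [mul_nonneg (mul_nonneg (sub_nonneg.2 hst.le) (sub_nonneg.2 (h2 hst)))
            (sub_nonneg.2 hrs.le)]
        · nlinarith [mul_nonneg (mul_nonneg (sub_nonneg.2 hst) (sub_nonneg.2 hrs.le))
            (sub_nonneg.2 (hst.trans hrs.le))]
  have hp : ∀ t : ℝ, ¬ Real.pi < angle (t : Bdry) := fun t => not_lt.2 (angle_coe_lt_pi t).le
  unfold PosOrder
  induction a using OnePoint.rec with
  | infty =>
    induction b using OnePoint.rec <;> induction c using OnePoint.rec <;>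
      simp [hp, angle_coe_lt_coe, angle_coe_lt_pi, -angle_coe]
  | coe r =>
    induction b using OnePoint.rec with
    | infty =>
      induction c using OnePoint.rec <;>
        simp [hp, angle_coe_lt_coe, angle_coe_lt_pi, -angle_coe]
    | coe s =>
      induction c using OnePoint.rec with
      | infty => simp [hp, angle_coe_lt_coe, angle_coe_lt_pi, -angle_coe]
      | coe t =>
        simp only [angle_coe_lt_coe, wedge_coe_coe]
        exact key r s t

lemma PosOrder.rotate {a b c : Bdry} (h : PosOrder a b c) : PosOrder b c a := by
  unfold PosOrder at *; tauto

lemma PosOrder.ne {a b c : Bdry} (h : PosOrder a b c) : a ≠ b := by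
  rintro rfl
  rw [posOrder_iff_wedge] at h
  simp at h

lemma PosOrder.not_swap {a b c : Bdry} (h : PosOrder a b c) : ¬ PosOrder a c b := by
  rw [posOrder_iff_wedge] at *
  rw [wedge_swap c a, wedge_swap b c, wedge_swap a b]
  intro h'
  linarith [show -wedge c a * -wedge b c * -wedge a b = - (wedge a b * wedge b c * wedge c a) by
    ring]

lemma posOrder_or_swap {a b c : Bdry} (hab : a ≠ b) (hbc : b ≠ c) (hca : c ≠ a) :
    PosOrder a b c ∨ PosOrder a c b := by
  rw [posOrder_iff_wedge, posOrder_iff_wedge, wedge_swap c a, wedge_swap b c, wedge_swap a b]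
  have := mul_ne_zero (mul_ne_zero (mt wedge_eq_zero.1 hab) (mt wedge_eq_zero.1 hbc))
    (mt wedge_eq_zero.1 hca)
  rcases this.lt_or_gt with h | h
  · right; nlinarith
  · left; exact h

lemma posOrder_coe_coe_infty {s t : ℝ} :
    PosOrder (s : Bdry) (t : Bdry) OnePoint.infty ↔ s < t := by
  simp [posOrder_iff_wedge]

lemma posOrder_coe_of_lt {r s t : ℝ} (h1 : r < s) (h2 : s < t) :
    PosOrder (r : Bdry) (s : Bdry) (t : Bdry) :=
  Or.inl ⟨angle_coe_lt_coe.2 h1, angle_coe_lt_coe.2 h2⟩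

lemma posOrder_coe_iff {r s t : ℝ} (h : r < t) :
    PosOrder (r : Bdry) (s : Bdry) (t : Bdry) ↔ r < s ∧ s < t := by
  simp only [PosOrder, angle_coe_lt_coe]
  constructor
  · rintro (h' | h' | h')
    · exact h'
    · exact absurd h'.2 (not_lt.2 h.le)
    · exact absurd h'.1 (not_lt.2 h.le)
  · exact Or.inl

/-- A map of the boundary preserves the cyclic order. -/
def CyclicMono (f : Bdry → Bdry) : Prop :=
  ∀ a b c : Bdry, PosOrder a b c → PosOrder (f a) (f b) (f c)

lemma exists_ne_ne (x y : Bdry) : ∃ z : Bdry, z ≠ x ∧ z ≠ y := by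
  have hinf : Infinite Bdry := Infinite.of_injective ((↑) : ℝ → Bdry) OnePoint.coe_injective
  obtain ⟨z, hz⟩ := ((Set.finite_singleton y).insert x).exists_notMem
  exact ⟨z, fun h => hz (by simp [h]), fun h => hz (by simp [h])⟩

lemma CyclicMono.injective {f : Bdry → Bdry} (hf : CyclicMono f) : Function.Injective f := by
  intro x y hxy
  by_contra hne
  obtain ⟨z, hzx, hzy⟩ := exists_ne_ne x y
  rcases posOrder_or_swap hne hzy.symm hzx with h | h
  · exact (hf _ _ _ h).ne hxy
  · exact (hf _ _ _ h).rotate.rotate.ne hxy.symm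

lemma CyclicMono.posOrder_iff {f : Bdry → Bdry} (hf : CyclicMono f) {a b c : Bdry} :
    PosOrder (f a) (f b) (f c) ↔ PosOrder a b c := by
  refine ⟨fun h => ?_, hf a b c⟩
  have h1 : a ≠ b := fun e => h.ne (congrArg f e)
  have h2 : b ≠ c := fun e => h.rotate.ne (congrArg f e)
  have h3 : c ≠ a := fun e => h.rotate.rotate.ne (congrArg f e)
  rcases posOrder_or_swap h1 h2 h3 with h' | h'
  · exact h'
  · exact absurd (hf _ _ _ h') h.not_swap

lemma CyclicMono.symm {f : Bdry ≃ₜ Bdry} (hf : CyclicMono f) : CyclicMono f.symm := by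
  intro a b c h
  rw [← hf.posOrder_iff]
  simpa using h

/-! ### Möbius action of matrices of determinant 1. -/

/-- The boundary point with given homogeneous coordinates. -/
noncomputable def ofVec (u v : ℝ) : Bdry := if v = 0 then OnePoint.infty else ((u / v : ℝ) : Bdry)

lemma ofVec_zero (u : ℝ) : ofVec u 0 = OnePoint.infty := by simp [ofVec]

lemma ofVec_of_ne {u v : ℝ} (hv : v ≠ 0) : ofVec u v = ((u / v : ℝ) : Bdry) := by simp [ofVec, hv]

lemma frac_eq_ofVec (p q : ℤ) : frac p q = ofVec p q := by simp [frac, ofVec]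

lemma exists_scale {u v : ℝ} (h : u ≠ 0 ∨ v ≠ 0) :
    ∃ l : ℝ, l ≠ 0 ∧ u = l * vecX (ofVec u v) ∧ v = l * vecY (ofVec u v) := by
  by_cases hv : v = 0
  · subst hv
    rw [ofVec_zero]
    exact ⟨u, by simpa using h, by simp, by simp⟩
  · rw [ofVec_of_ne hv]
    exact ⟨v, hv, by simp; field_simp, by simp⟩

lemma ofVec_smul {l : ℝ} (hl : l ≠ 0) (u v : ℝ) : ofVec (l * u) (l * v) = ofVec u v := by
  by_cases hv : v = 0
  · simp [hv, ofVec]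
  · rw [ofVec_of_ne hv, ofVec_of_ne (mul_ne_zero hl hv), mul_div_mul_left _ _ hl]

lemma ofVec_vec (x : Bdry) : ofVec (vecX x) (vecY x) = x := by
  induction x using OnePoint.rec <;> simp [ofVec]

lemma vec_ne_zero (x : Bdry) : vecX x ≠ 0 ∨ vecY x ≠ 0 := by
  induction x using OnePoint.rec <;> simp

lemma sl_vec_ne_zero {p q r s u v : ℝ} (hA : p * s - q * r = 1) (h : u ≠ 0 ∨ v ≠ 0) :
    p * u + q * v ≠ 0 ∨ r * u + s * v ≠ 0 := by
  by_contra! hc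
  obtain ⟨h1, h2⟩ := hc
  have hu : u = 0 := by linear_combination s * h1 - q * h2 - u * hA
  have hv : v = 0 := by linear_combination p * h2 - r * h1 - v * hA
  tauto

/-- The Möbius action of the matrix with rows `(p, q)` and `(r, s)`. -/
noncomputable def mob (p q r s : ℝ) (x : Bdry) : Bdry :=
  ofVec (p * vecX x + q * vecY x) (r * vecX x + s * vecY x)

lemma mob_ofVec {p q r s u v : ℝ} (h : u ≠ 0 ∨ v ≠ 0) :
    mob p q r s (ofVec u v) = ofVec (p * u + q * v) (r * u + s * v) := by
  obtain ⟨l, hl, h1, h2⟩ := exists_scale h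
  rw [mob, ← ofVec_smul hl]
  congr 1
  · linear_combination (-p) * h1 - q * h2
  · linear_combination (-r) * h1 - s * h2

lemma mob_mob_inv {p q r s : ℝ} (hA : p * s - q * r = 1) (x : Bdry) :
    mob s (-q) (-r) p (mob p q r s x) = x := by
  conv_lhs => rw [mob.eq_def p q r s x]
  rw [mob_ofVec (sl_vec_ne_zero hA (vec_ne_zero x))]
  conv_rhs => rw [← ofVec_vec x]
  congr 1
  · linear_combination vecX x * hA
  · linear_combination vecY x * hA

/-- A matrix of determinant 1 preserves determinants of vectors; only the renormalisation of each
vector enters, as one factor per point. Such factors cancel in cyclic orders and cross ratios. -/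
lemma exists_wedge_mob {p q r s : ℝ} (hA : p * s - q * r = 1) :
    ∃ l : Bdry → ℝ, (∀ x, l x ≠ 0) ∧
      ∀ x y, wedge x y = l x * l y * wedge (mob p q r s x) (mob p q r s y) := by
  choose l hl h1 h2 using fun x : Bdry => exists_scale (sl_vec_ne_zero hA (vec_ne_zero x))
  refine ⟨l, hl, fun x y => ?_⟩
  have e : wedge x y = (p * vecX x + q * vecY x) * (r * vecX y + s * vecY y) -
      (p * vecX y + q * vecY y) * (r * vecX x + s * vecY x) := by
    simp only [wedge]
    linear_combination (vecX y * vecY x - vecX x * vecY y) * hA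
  have h1' : ∀ x, p * vecX x + q * vecY x = l x * vecX (mob p q r s x) := h1
  have h2' : ∀ x, r * vecX x + s * vecY x = l x * vecY (mob p q r s x) := h2
  rw [e, h1' x, h1' y, h2' x, h2' y, wedge]
  ring

lemma cyclicMono_mob {p q r s : ℝ} (hA : p * s - q * r = 1) : CyclicMono (mob p q r s) := by
  intro a b c h
  obtain ⟨l, hl, hw⟩ := exists_wedge_mob hA
  rw [posOrder_iff_wedge] at *
  rw [hw a b, hw b c, hw c a] at h
  have : 0 < (l a * l b * l c) ^ 2 := by
    have := mul_ne_zero (mul_ne_zero (hl a) (hl b)) (hl c)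
    positivity
  refine (mul_pos_iff_of_pos_left this).1 ?_
  refine h.trans_eq ?_
  ring

/-! ### Denominators, integral determinants and Farey edges. -/

open Classical in
/-- The denominator of a rational boundary point (`1` at infinity), and `0` for irrational
points. -/
noncomputable def den (x : Bdry) : ℕ :=
  x.elim 1 (fun t => if h : ∃ r : ℚ, (r : ℝ) = t then h.choose.den else 0)

@[simp] lemma den_infty : den OnePoint.infty = 1 := rfl

lemma den_ratCast (r : ℚ) : den ((r : ℝ) : Bdry) = r.den := by
  have h : ∃ r' : ℚ, (r' : ℝ) = (r : ℝ) := ⟨r, rfl⟩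
  simp only [den, OnePoint.elim_some, dif_pos h]
  congr 1
  exact_mod_cast h.choose_spec

lemma exists_rat_of_den_ne_zero {t : ℝ} (h : den (t : Bdry) ≠ 0) : ∃ r : ℚ, (r : ℝ) = t := by
  by_contra hc
  simp [den, hc] at h

lemma frac_int_pos (p q : ℤ) (hq : q ≠ 0) : frac p q = (((p / q : ℚ) : ℝ) : Bdry) := by
  simp [frac, hq]

lemma exists_scale_frac {p q : ℤ} (h : IsCoprime p q) :
    ∃ l : ℝ, |l| = den (frac p q) ∧ (p : ℝ) = l * vecX (frac p q) ∧
      (q : ℝ) = l * vecY (frac p q) := by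
  by_cases hq : q = 0
  · subst hq
    have hp : IsUnit p := isCoprime_zero_right.1 h
    have hf : frac p 0 = OnePoint.infty := by simp [frac]
    rw [hf]
    refine ⟨p, ?_, by simp, by simp⟩
    rcases Int.isUnit_iff.1 hp with rfl | rfl <;> simp
  · rw [frac_int_pos p q hq, den_ratCast]
    refine ⟨q, ?_, ?_, by simp⟩
    · have hcop : p.natAbs.Coprime q.natAbs := Int.isCoprime_iff_gcd_eq_one.1 h
      have : ((p / q : ℚ)).den = q.natAbs := by
        rcases lt_or_gt_of_ne hq with hlt | hgt
        · have e : (p / q : ℚ) = ((-p : ℤ) : ℚ) / ((-q : ℤ) : ℚ) := by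
            push_cast; rw [neg_div_neg_eq]
          rw [e]
          have := Rat.den_div_eq_of_coprime (a := -p) (b := -q) (by omega) (by simpa using hcop)
          omega
        · have := Rat.den_div_eq_of_coprime (a := p) (b := q) hgt hcop
          omega
      rw [this, Nat.cast_natAbs]
      simp
    · have : (q : ℝ) ≠ 0 := by exact_mod_cast hq
      simp; field_simp

lemma exists_frac_of_den_ne_zero {x : Bdry} (h : den x ≠ 0) :
    ∃ p q : ℤ, IsCoprime p q ∧ x = frac p q := by
  induction x using OnePoint.rec with
  | infty => exact ⟨1, 0, isCoprime_one_left, by simp [frac]⟩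
  | coe t =>
    obtain ⟨r, rfl⟩ := exists_rat_of_den_ne_zero h
    refine ⟨r.num, r.den, r.isCoprime_num_den, ?_⟩
    have e : ((r.num : ℤ) : ℚ) / ((r.den : ℤ) : ℚ) = r := by exact_mod_cast r.num_div_den
    rw [frac_int_pos r.num r.den (Int.natCast_ne_zero.2 r.den_nz), e]

lemma den_frac_ne_zero (p q : ℤ) : den (frac p q) ≠ 0 := by
  by_cases hq : q = 0
  · simp [hq, frac]
  · rw [frac_int_pos p q hq, den_ratCast]
    exact Rat.den_nz _

/-- The absolute value of the determinant of the primitive integral vectors which represent two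
rational boundary points (`0` if one of the points is irrational). -/
noncomputable def intDet (x y : Bdry) : ℝ := den x * den y * |wedge x y|

lemma intDet_comm (x y : Bdry) : intDet x y = intDet y x := by
  rw [intDet, intDet, wedge_swap x y, abs_neg]; ring

@[simp] lemma intDet_self (x : Bdry) : intDet x x = 0 := by simp [intDet]

lemma intDet_frac {p q r s : ℤ} (h : IsCoprime p q) (h' : IsCoprime r s) :
    intDet (frac p q) (frac r s) = |((p * s - q * r : ℤ) : ℝ)| := by
  obtain ⟨l, hl, h1, h2⟩ := exists_scale_frac h
  obtain ⟨m, hm, h3, h4⟩ := exists_scale_frac h'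
  rw [intDet, ← hl, ← hm, ← abs_mul, ← abs_mul]
  congr 1
  push_cast
  rw [h1, h2, h3, h4, wedge]
  ring

lemma exists_nat_intDet (x y : Bdry) : ∃ n : ℕ, intDet x y = n := by
  by_cases hx : den x = 0
  · exact ⟨0, by simp [intDet, hx]⟩
  by_cases hy : den y = 0
  · exact ⟨0, by simp [intDet, hy]⟩
  obtain ⟨p, q, h, rfl⟩ := exists_frac_of_den_ne_zero hx
  obtain ⟨r, s, h', rfl⟩ := exists_frac_of_den_ne_zero hy
  refine ⟨(p * s - q * r).natAbs, ?_⟩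
  rw [intDet_frac h h', Nat.cast_natAbs]
  simp

lemma den_left_ne_zero {x y : Bdry} (h : intDet x y ≠ 0) : den x ≠ 0 := by
  intro h'; simp [intDet, h'] at h

lemma den_right_ne_zero {x y : Bdry} (h : intDet x y ≠ 0) : den y ≠ 0 := by
  intro h'; simp [intDet, h'] at h

lemma ne_of_intDet_ne_zero {x y : Bdry} (h : intDet x y ≠ 0) : x ≠ y := by
  rintro rfl; simp at h

lemma one_le_intDet {x y : Bdry} (hx : den x ≠ 0) (hy : den y ≠ 0) (hxy : x ≠ y) :
    1 ≤ intDet x y := by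
  obtain ⟨n, hn⟩ := exists_nat_intDet x y
  have : intDet x y ≠ 0 := by
    unfold intDet
    have := mt wedge_eq_zero.1 hxy
    have := abs_ne_zero.2 this
    positivity
  rw [hn] at this ⊢
  exact_mod_cast Nat.one_le_iff_ne_zero.2 (by exact_mod_cast this)

lemma isCoprime_of_abs_det {p q r s : ℤ} (h : |p * s - q * r| = 1) :
    IsCoprime p q ∧ IsCoprime r s := by
  rcases (abs_eq one_pos.le).1 h with h | h
  · exact ⟨⟨s, -r, by linarith⟩, ⟨-q, p, by linarith⟩⟩
  · exact ⟨⟨-s, r, by linarith⟩, ⟨q, -p, by linarith⟩⟩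

/-- Rationality of both points is hidden in the right-hand side, because `den` vanishes at
irrational points. -/
lemma mem_farey {x y : Bdry} : s(x, y) ∈ farey ↔ intDet x y = 1 := by
  constructor
  · rintro ⟨p, q, r, s, h, he⟩
    obtain ⟨h1, h2⟩ := isCoprime_of_abs_det h
    have : intDet (frac p q) (frac r s) = 1 := by
      rw [intDet_frac h1 h2]
      exact_mod_cast h
    rcases Sym2.eq_iff.1 he with ⟨rfl, rfl⟩ | ⟨rfl, rfl⟩
    · exact this
    · rwa [intDet_comm]
  · intro h
    have h0 : intDet x y ≠ 0 := by rw [h]; exact one_ne_zero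
    obtain ⟨p, q, h1, rfl⟩ := exists_frac_of_den_ne_zero (den_left_ne_zero h0)
    obtain ⟨r, s, h2, rfl⟩ := exists_frac_of_den_ne_zero (den_right_ne_zero h0)
    rw [intDet_frac h1 h2] at h
    exact ⟨p, q, r, s, by exact_mod_cast h, rfl⟩

lemma posOrder_frac {p q r s u v : ℤ} (h1 : IsCoprime p q) (h2 : IsCoprime r s)
    (h3 : IsCoprime u v) : PosOrder (frac p q) (frac r s) (frac u v) ↔
      0 < (p * s - q * r) * (r * v - s * u) * (u * q - v * p) := by
  obtain ⟨l, hl, e1, e2⟩ := exists_scale_frac h1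
  obtain ⟨m, hm, e3, e4⟩ := exists_scale_frac h2
  obtain ⟨n, hn, e5, e6⟩ := exists_scale_frac h3
  have hl0 : l ≠ 0 := by
    rintro rfl; simp at hl; exact den_frac_ne_zero _ _ (by exact_mod_cast hl.symm)
  have hm0 : m ≠ 0 := by
    rintro rfl; simp at hm; exact den_frac_ne_zero _ _ (by exact_mod_cast hm.symm)
  have hn0 : n ≠ 0 := by
    rintro rfl; simp at hn; exact den_frac_ne_zero _ _ (by exact_mod_cast hn.symm)
  rw [posOrder_iff_wedge]
  have : (((p * s - q * r) * (r * v - s * u) * (u * q - v * p) : ℤ) : ℝ) = (l * m * n) ^ 2 *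
      (wedge (frac p q) (frac r s) * wedge (frac r s) (frac u v) *
        wedge (frac u v) (frac p q)) := by
    push_cast
    rw [e1, e2, e3, e4, e5, e6]
    simp only [wedge]
    ring
  have hpos : 0 < (l * m * n) ^ 2 := by positivity
  rw [← Int.cast_pos (R := ℝ), this, mul_pos_iff_of_pos_left hpos]

lemma exists_farey_third {x y : Bdry} (h : intDet x y = 1) :
    ∃ z, PosOrder x z y ∧ intDet x z = 1 ∧ intDet z y = 1 := by
  have h0 : intDet x y ≠ 0 := by rw [h]; exact one_ne_zero
  obtain ⟨p, q, h1, rfl⟩ := exists_frac_of_den_ne_zero (den_left_ne_zero h0)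
  obtain ⟨r, s, h2, rfl⟩ := exists_frac_of_den_ne_zero (den_right_ne_zero h0)
  rw [intDet_frac h1 h2] at h
  have h' : |p * s - q * r| = 1 := by exact_mod_cast h
  -- The common Farey neighbours of the two points are the sum and the difference of their vectors;
  -- the sign `e` selects the one on the positive arc from the first point to the second.
  have key : ∀ e : ℤ, |e| = 1 → e = -(p * s - q * r) →
      ∃ z, PosOrder (frac p q) z (frac r s) ∧ intDet (frac p q) z = 1 ∧
        intDet z (frac r s) = 1 := by
    intro e he1 he
    have he2 : e * e = 1 := by rw [← abs_mul_abs_self, he1]; rfl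
    have d1 : p * (s + e * q) - q * (r + e * p) = -e := by rw [he]; ring
    have d2 : (r + e * p) * s - (s + e * q) * r = -1 := by
      linear_combination (-1 : ℤ) * he2 + e * he
    have hc : IsCoprime (r + e * p) (s + e * q) :=
      (isCoprime_of_abs_det (by rw [d1, abs_neg, he1])).2
    refine ⟨frac (r + e * p) (s + e * q), ?_, ?_, ?_⟩
    · rw [posOrder_frac h1 hc h2, d1, d2, show r * q - s * p = e by rw [he]; ring]
      rw [show -e * -1 * e = e * e by ring, he2]
      exact one_pos
    · rw [intDet_frac h1 hc, d1]
      exact_mod_cast (by rw [abs_neg, he1] : |(-e)| = 1)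
    · rw [intDet_frac hc h2, d2]
      simp
  exact key _ (by rwa [abs_neg]) rfl

lemma isCoprime_sl {p q r s a b : ℤ} (hA : p * s - q * r = 1) (h : IsCoprime a b) :
    IsCoprime (p * a + q * b) (r * a + s * b) := by
  obtain ⟨u, v, huv⟩ := h
  exact ⟨u * s - v * r, v * p - u * q, by linear_combination huv + (u * a + v * b) * hA⟩

lemma mob_frac {p q r s a b : ℤ} (h : IsCoprime a b) :
    mob p q r s (frac a b) = frac (p * a + q * b) (r * a + s * b) := by
  rw [frac_eq_ofVec, frac_eq_ofVec, mob_ofVec]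
  · push_cast; rfl
  · by_contra! hc
    obtain ⟨h1, h2⟩ := hc
    have h1' : a = 0 := by exact_mod_cast h1
    have h2' : b = 0 := by exact_mod_cast h2
    subst h1' h2'
    exact not_isCoprime_zero_zero h

lemma intDet_mob_of_ne_zero {p q r s : ℤ} (hA : p * s - q * r = 1) {x y : Bdry}
    (hx : den x ≠ 0) (hy : den y ≠ 0) :
    intDet (mob p q r s x) (mob p q r s y) = intDet x y := by
  obtain ⟨a, b, h1, rfl⟩ := exists_frac_of_den_ne_zero hx
  obtain ⟨c, d, h2, rfl⟩ := exists_frac_of_den_ne_zero hy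
  rw [mob_frac h1, mob_frac h2, intDet_frac (isCoprime_sl hA h1) (isCoprime_sl hA h2),
    intDet_frac h1 h2]
  congr 2
  linear_combination (a * d - b * c) * hA

/-! ### Farey-bounded maps: metric estimates when infinity is fixed. -/

/-- A map of the boundary which preserves the cyclic order and sends Farey edges to pairs of
rational points with determinant at most `K`. -/
structure FareyBounded (K : ℝ) (f : Bdry → Bdry) : Prop where
  mono : CyclicMono f
  bound : ∀ x y, intDet x y = 1 → intDet (f x) (f y) ≠ 0 ∧ intDet (f x) (f y) ≤ K

lemma FareyBounded.comp_mob {K : ℝ} {f : Bdry → Bdry} (hf : FareyBounded K f) {p q r s : ℤ}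
    (hA : p * s - q * r = 1) : FareyBounded K (fun x => f (mob p q r s x)) where
  mono a b c h := hf.mono _ _ _ (cyclicMono_mob (by exact_mod_cast hA) _ _ _ h)
  bound x y h := by
    have h0 : intDet x y ≠ 0 := by rw [h]; exact one_ne_zero
    refine hf.bound _ _ ?_
    rw [intDet_mob_of_ne_zero hA (den_left_ne_zero h0) (den_right_ne_zero h0), h]

lemma FareyBounded.mob_comp {K : ℝ} {f : Bdry → Bdry} (hf : FareyBounded K f) {p q r s : ℤ}
    (hA : p * s - q * r = 1) : FareyBounded K (fun x => mob p q r s (f x)) where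
  mono a b c h := cyclicMono_mob (by exact_mod_cast hA) _ _ _ (hf.mono _ _ _ h)
  bound x y h := by
    have h0 := hf.bound x y h
    rwa [intDet_mob_of_ne_zero hA (den_left_ne_zero h0.1) (den_right_ne_zero h0.1)]

lemma exists_mob_eq_infty {x : Bdry} (hx : den x ≠ 0) :
    ∃ p q r s : ℤ, p * s - q * r = 1 ∧ mob p q r s x = OnePoint.infty := by
  obtain ⟨a, b, h, rfl⟩ := exists_frac_of_den_ne_zero hx
  have h' := h
  obtain ⟨u, v, huv⟩ := h
  refine ⟨u, v, -b, a, by linarith, ?_⟩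
  rw [mob_frac h', show -b * a + a * b = 0 by ring]
  simp [frac]

lemma intDet_coe_coe (x y : ℝ) :
    intDet (x : Bdry) (y : Bdry) = den (x : Bdry) * den (y : Bdry) * |x - y| := by
  simp [intDet]

lemma intDet_coe_infty (x : ℝ) : intDet (x : Bdry) OnePoint.infty = den (x : Bdry) := by
  simp [intDet]

lemma frac_num_den (r : ℚ) : frac r.num r.den = ((r : ℝ) : Bdry) := by
  have e : ((r.num : ℤ) : ℚ) / ((r.den : ℤ) : ℚ) = r := by exact_mod_cast r.num_div_den
  rw [frac_int_pos r.num r.den (Int.natCast_ne_zero.2 r.den_nz), e]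

lemma den_intCast (n : ℤ) : den ((n : ℝ) : Bdry) = 1 := by
  have := den_ratCast (n : ℚ)
  simpa using this

lemma frac_coe_of_pos {p q : ℤ} (hq : 0 < q) : frac p q = ((p / q : ℝ) : Bdry) := by
  simp [frac, hq.ne']

/-- `s` is the inverse of `p` modulo `q`. The other parent is (p - r)/(q - s). -/
lemma exists_farey_parents {p q : ℤ} (h : IsCoprime p q) (hq : 1 < q) :
    ∃ r s : ℤ, 0 < s ∧ s < q ∧ p * s - q * r = 1 := by
  obtain ⟨u, v, huv⟩ := h
  have hs0 : u % q ≠ 0 := by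
    intro h0
    have : q ∣ 1 := by
      rw [← huv]
      exact dvd_add ((Int.dvd_of_emod_eq_zero h0).mul_right p) (dvd_mul_left q v)
    have := Int.le_of_dvd one_pos this
    omega
  have h1 := Int.emod_nonneg u (show q ≠ 0 by omega)
  have h2 := Int.emod_lt_of_pos u (show 0 < q by omega)
  refine ⟨-v - p * (u / q), u % q, by omega, h2, ?_⟩
  have := Int.emod_add_mul_ediv u q
  linear_combination huv + p * this

lemma FareyBounded.exists_real {K : ℝ} {f : Bdry → Bdry} (hf : FareyBounded K f)
    (hinf : f OnePoint.infty = OnePoint.infty) :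
    ∃ φ : ℝ → ℝ, StrictMono φ ∧ ∀ t : ℝ, f t = (φ t : Bdry) := by
  have : ∀ t : ℝ, ∃ s : ℝ, f t = (s : Bdry) := by
    intro t
    have : f t ≠ OnePoint.infty := by
      rw [← hinf]
      exact fun h => OnePoint.coe_ne_infty t (hf.mono.injective h)
    obtain ⟨s, hs⟩ := OnePoint.ne_infty_iff_exists.1 this
    exact ⟨s, hs.symm⟩
  choose φ hφ using this
  refine ⟨φ, fun s t hst => ?_, hφ⟩
  have := hf.mono _ _ _ (posOrder_coe_coe_infty.2 hst)
  rwa [hφ, hφ, hinf, posOrder_coe_coe_infty] at this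

lemma FareyBounded.one_le {K : ℝ} {f : Bdry → Bdry} (hf : FareyBounded K f) : 1 ≤ K := by
  have h : intDet ((0 : ℤ) : ℝ) OnePoint.infty = 1 := by
    rw [intDet_coe_infty, den_intCast]; simp
  obtain ⟨h1, h2⟩ := hf.bound _ _ h
  exact (one_le_intDet (den_left_ne_zero h1) (den_right_ne_zero h1)
    (ne_of_intDet_ne_zero h1)).trans h2

section
variable {K : ℝ} {f : Bdry → Bdry} {φ : ℝ → ℝ}

lemma FareyBounded.den_apply_int (hf : FareyBounded K f)
    (hinf : f OnePoint.infty = OnePoint.infty) (hφ : ∀ t : ℝ, f t = (φ t : Bdry)) (n : ℤ) :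
    (1 : ℝ) ≤ den (φ n : Bdry) ∧ (den (φ n : Bdry) : ℝ) ≤ K := by
  have h : intDet ((n : ℝ) : Bdry) OnePoint.infty = 1 := by
    rw [intDet_coe_infty, den_intCast]; simp
  obtain ⟨h1, h2⟩ := hf.bound _ _ h
  rw [hinf, hφ, intDet_coe_infty] at h1 h2
  exact ⟨by exact_mod_cast Nat.one_le_iff_ne_zero.2 (by exact_mod_cast h1), h2⟩

/-- Both image points have denominators between 1 and `K`, as neighbours of infinity, while the
product of the denominators and the gap lies between 1 and `K`. -/
lemma FareyBounded.step_bounds (hf : FareyBounded K f)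
    (hinf : f OnePoint.infty = OnePoint.infty) (hmono : StrictMono φ)
    (hφ : ∀ t : ℝ, f t = (φ t : Bdry)) (n : ℤ) :
    1 / K ^ 2 ≤ φ (n + 1) - φ n ∧ φ (n + 1) - φ n ≤ K := by
  have h : intDet ((n : ℝ) : Bdry) (((n + 1 : ℤ) : ℝ) : Bdry) = 1 := by
    rw [intDet_coe_coe, den_intCast, den_intCast]; simp
  obtain ⟨h1, h2⟩ := hf.bound _ _ h
  have h3 := one_le_intDet (den_left_ne_zero h1) (den_right_ne_zero h1)
    (ne_of_intDet_ne_zero h1)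
  have a1 := hf.den_apply_int hinf hφ n
  have a2 := hf.den_apply_int hinf hφ (n + 1)
  rw [hφ, hφ, intDet_coe_coe] at h2 h3
  push_cast at h2 h3 a2
  have hlt : φ n < φ (n + 1) := hmono (by linarith)
  rw [abs_sub_comm, abs_of_pos (by linarith)] at h2 h3
  generalize (den (φ n : Bdry) : ℝ) = d at *
  generalize (den (φ (n + 1) : Bdry) : ℝ) = e at *
  have hpos : 0 < φ (n + 1) - φ n := by linarith
  have hde : 1 ≤ d * e := one_le_mul_of_one_le_of_one_le a1.1 a2.1
  have hdeK : d * e ≤ K ^ 2 := by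
    rw [pow_two]; exact mul_le_mul a1.2 a2.2 (by linarith) (by linarith)
  constructor
  · rw [div_le_iff₀ (by nlinarith)]
    nlinarith
  · nlinarith

lemma FareyBounded.steps_bounds (hf : FareyBounded K f)
    (hinf : f OnePoint.infty = OnePoint.infty) (hmono : StrictMono φ)
    (hφ : ∀ t : ℝ, f t = (φ t : Bdry)) (n : ℤ) (m : ℕ) :
    m * (1 / K ^ 2) ≤ φ (n + m) - φ n ∧ φ (n + m) - φ n ≤ m * K := by
  induction m with
  | zero => simp
  | succ m ih =>
    have := hf.step_bounds hinf hmono hφ (n + m)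
    push_cast at this ⊢
    rw [add_assoc] at this
    constructor <;> linarith [ih.1, ih.2]

/-- Let x, y, z be the images of p/q and its two Farey parents, with denominators X, Y, Z. Since
YZ|y - z| ≥ 1, the triangle inequality gives X ≤ Z · XY|x - y| + Y · XZ|x - z| ≤ K(Y + Z), so each
generation costs a factor of at most 2K. -/
lemma FareyBounded.den_frac_le (hf : FareyBounded K f)
    (hinf : f OnePoint.infty = OnePoint.infty) (hφ : ∀ t : ℝ, f t = (φ t : Bdry)) (n : ℕ) :
    ∀ p q : ℤ, IsCoprime p q → 0 < q → q ≤ n → (den (f (frac p q)) : ℝ) ≤ (2 * K) ^ n := by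
  have hK := hf.one_le
  induction n with
  | zero => intro p q _ h1 h2; simp at h2; omega
  | succ n ih =>
    intro p q hpq hq hqn
    rcases eq_or_lt_of_le (show 1 ≤ q by omega) with rfl | hq1
    · have := (hf.den_apply_int hinf hφ p).2
      rw [frac_coe_of_pos one_pos, hφ]
      have h2 : (1 : ℝ) ≤ (2 * K) ^ n := one_le_pow₀ (by linarith)
      simp only [Int.cast_one, div_one]
      rw [pow_succ]
      nlinarith
    · obtain ⟨r, s, hs, hsq, hdet⟩ := exists_farey_parents hpq hq1
      have c1 : IsCoprime r s := ⟨-q, p, by linarith⟩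
      have c2 : IsCoprime (p - r) (q - s) := ⟨q, -p, by linear_combination hdet⟩
      have b1 := ih r s c1 hs (by push_cast at hqn; omega)
      have b2 := ih (p - r) (q - s) c2 (by omega) (by push_cast at hqn; omega)
      have d1 : intDet (frac p q) (frac r s) = 1 := by
        rw [intDet_frac hpq c1, hdet]; simp
      have d2 : intDet (frac p q) (frac (p - r) (q - s)) = 1 := by
        rw [intDet_frac hpq c2, show p * (q - s) - q * (p - r) = -1 by linarith]; simp
      have d3 : intDet (frac r s) (frac (p - r) (q - s)) = 1 := by
        rw [intDet_frac c1 c2, show r * (q - s) - s * (p - r) = -1 by linarith]; simp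
      obtain ⟨e1, e1'⟩ := hf.bound _ _ d1
      obtain ⟨e2, e2'⟩ := hf.bound _ _ d2
      obtain ⟨e3, -⟩ := hf.bound _ _ d3
      have e3' := one_le_intDet (den_left_ne_zero e3) (den_right_ne_zero e3)
        (ne_of_intDet_ne_zero e3)
      rw [frac_coe_of_pos hq, hφ] at *
      rw [frac_coe_of_pos hs, hφ] at *
      rw [frac_coe_of_pos (show 0 < q - s by omega), hφ] at *
      rw [intDet_coe_coe] at e1' e2' e3'
      generalize φ (p / q) = x at *
      generalize φ (r / s) = y at *
      generalize φ ((p - r : ℤ) / (q - s : ℤ)) = z at *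
      have h0 : (0 : ℝ) ≤ den (x : Bdry) := by positivity
      have h1 : (0 : ℝ) ≤ den (y : Bdry) := by positivity
      have h2 : (0 : ℝ) ≤ den (z : Bdry) := by positivity
      have tri : |y - z| ≤ |x - y| + |x - z| := by
        rw [abs_sub_comm x y]; exact abs_sub_le y x z
      generalize (den (x : Bdry) : ℝ) = X at *
      generalize (den (y : Bdry) : ℝ) = Y at *
      generalize (den (z : Bdry) : ℝ) = Z at *
      calc X ≤ X * (Y * Z * |y - z|) := le_mul_of_one_le_right h0 e3'
        _ ≤ X * (Y * Z * (|x - y| + |x - z|)) := by gcongr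
        _ = Z * (X * Y * |x - y|) + Y * (X * Z * |x - z|) := by ring
        _ ≤ Z * K + Y * K := by gcongr
        _ ≤ (2 * K) ^ n * K + (2 * K) ^ n * K := by gcongr
        _ = (2 * K) ^ (n + 1) := by ring

lemma FareyBounded.den_rat_le (hf : FareyBounded K f)
    (hinf : f OnePoint.infty = OnePoint.infty) (hφ : ∀ t : ℝ, f t = (φ t : Bdry)) (r : ℚ) {n : ℕ}
    (hr : r.den ≤ n) :
    (1 : ℝ) ≤ den (φ r : Bdry) ∧ (den (φ r : Bdry) : ℝ) ≤ (2 * K) ^ n := by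
  constructor
  · obtain ⟨u, v, huv⟩ := r.isCoprime_num_den
    have h : intDet ((r : ℝ) : Bdry) (frac (-v) u) = 1 := by
      rw [← frac_num_den, intDet_frac r.isCoprime_num_den ⟨-r.den, r.num, by linarith⟩,
        show r.num * u - r.den * -v = 1 by linarith]
      simp
    have := den_left_ne_zero (hf.bound _ _ h).1
    rw [hφ] at this
    exact_mod_cast Nat.one_le_iff_ne_zero.2 this
  · have := hf.den_frac_le hinf hφ n r.num r.den r.isCoprime_num_den
      (by exact_mod_cast r.den_pos) (by exact_mod_cast hr)
    rwa [frac_num_den, hφ] at this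

end

/-- At scales t ≥ √3/2, intervals of length at least t/2 keep length at least a multiple of t, and
those of length at most 6t stay below a multiple of t. Long intervals are measured by counting
integers in them, and those near scale 1 by fractions with denominator 5. -/
lemma fareyBounded_two_sided (K : ℝ) (hK : 1 ≤ K) : ∃ c C : ℝ, 0 < c ∧ 0 < C ∧
    ∀ (f : Bdry → Bdry) (φ : ℝ → ℝ), FareyBounded K f → f OnePoint.infty = OnePoint.infty →
      StrictMono φ → (∀ t : ℝ, f t = (φ t : Bdry)) → ∀ t : ℝ, 0 < t → 3 ≤ 4 * t ^ 2 →
        ∀ x y : ℝ, (t / 2 ≤ y - x → c * t ≤ φ y - φ x) ∧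
          (y - x ≤ 6 * t → φ y - φ x ≤ C * t) := by
  refine ⟨min (1 / (4 * K ^ 2)) (1 / (8 * ((2 * K) ^ 5) ^ 2)), 9 * K, by positivity, by positivity,
    ?_⟩
  intro f φ hf hinf hmono hφ t ht ht2 x y
  -- A rational number just below √3/2; what matters below is t/2 ≥ 2/5 and 6t + 2 ≤ 9t.
  have ht3 : 43 / 50 ≤ t := by nlinarith
  constructor
  · intro hxy
    rcases le_or_gt 8 t with h8 | h8
    · have h1 := Int.le_ceil x
      have h2 := Int.ceil_lt_add_one x
      have h3 := Int.floor_le y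
      have h4 := Int.lt_floor_add_one y
      obtain ⟨m, hm⟩ : ∃ m : ℕ, ⌊y⌋ = ⌈x⌉ + m := by
        refine ⟨(⌊y⌋ - ⌈x⌉).toNat, ?_⟩
        have : (⌈x⌉ : ℝ) ≤ ⌊y⌋ := by linarith
        have : ⌈x⌉ ≤ ⌊y⌋ := by exact_mod_cast this
        omega
      have hm' : (⌊y⌋ : ℝ) = ⌈x⌉ + m := by exact_mod_cast hm
      have := (hf.steps_bounds hinf hmono hφ ⌈x⌉ m).1
      rw [← hm'] at this
      have a1 : φ x ≤ φ ⌈x⌉ := hmono.monotone h1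
      have a2 : φ ⌊y⌋ ≤ φ y := hmono.monotone h3
      -- Rounding inwards loses less than 2, and t/2 - 2 ≥ t/4 because t ≥ 8.
      have hmt : t / 4 ≤ m := by linarith
      calc _ ≤ 1 / (4 * K ^ 2) * t := by gcongr; exact min_le_left _ _
        _ = t / 4 * (1 / K ^ 2) := by field_simp
        _ ≤ m * (1 / K ^ 2) := by gcongr
        _ ≤ φ y - φ x := by linarith
    -- An interval of length at least 2/5 contains two consecutive multiples of 1/5. Their images
    -- have denominators at most (2K)^5 and are therefore separated.
    · set k := ⌈5 * x⌉
      have h1 := Int.le_ceil (5 * x)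
      have h2 := Int.ceil_lt_add_one (5 * x)
      have hden : ∀ n : ℤ, ((n : ℚ) / 5).den ≤ 5 := by
        intro n
        have := Rat.den_dvd n 5
        have h5 : ((n : ℚ) / ((5 : ℤ) : ℚ)).den ∣ 5 := by exact_mod_cast this
        exact Nat.le_of_dvd (by norm_num) (by simpa using h5)
      have b1 := hf.den_rat_le hinf hφ ((k : ℚ) / 5) (hden k)
      have b2 := hf.den_rat_le hinf hφ (((k + 1 : ℤ) : ℚ) / 5) (hden (k + 1))
      push_cast at b1 b2
      have hlt : φ ((k : ℝ) / 5) < φ (((k : ℝ) + 1) / 5) := hmono (by linarith)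
      have h3 := one_le_intDet (x := (φ ((k : ℝ) / 5) : Bdry))
        (y := (φ (((k : ℝ) + 1) / 5) : Bdry))
        (by have := b1.1; intro h0; rw [h0] at this; norm_num at this)
        (by have := b2.1; intro h0; rw [h0] at this; norm_num at this)
        (fun h => hlt.ne (OnePoint.coe_injective h))
      rw [intDet_coe_coe, abs_sub_comm, abs_of_pos (by linarith)] at h3
      have a1 : φ x ≤ φ ((k : ℝ) / 5) := hmono.monotone (by linarith)
      have a2 : φ (((k : ℝ) + 1) / 5) ≤ φ y := hmono.monotone (by linarith)
      have hd : (den (φ ((k : ℝ) / 5) : Bdry) : ℝ) * den (φ (((k : ℝ) + 1) / 5) : Bdry) ≤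
          ((2 * K) ^ 5) ^ 2 := by
        rw [pow_two]; exact mul_le_mul b1.2 b2.2 (by positivity) (by positivity)
      have h4 : 1 ≤ ((2 * K) ^ 5) ^ 2 * (φ (((k : ℝ) + 1) / 5) - φ ((k : ℝ) / 5)) :=
        h3.trans (mul_le_mul_of_nonneg_right hd (by linarith))
      calc _ ≤ 1 / (8 * ((2 * K) ^ 5) ^ 2) * t := by gcongr; exact min_le_right _ _
        _ ≤ 1 / (8 * ((2 * K) ^ 5) ^ 2) * 8 := by gcongr
        _ = 1 / ((2 * K) ^ 5) ^ 2 := by field_simp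
        _ ≤ φ (((k : ℝ) + 1) / 5) - φ ((k : ℝ) / 5) := by
          rw [div_le_iff₀ (by positivity)]; linarith
        _ ≤ φ y - φ x := by linarith
  · intro hxy
    rcases le_or_gt y x with hyx | hyx
    · have := hmono.monotone hyx
      have : 0 < 9 * K * t := by positivity
      linarith
    have h1 := Int.floor_le x
    have h2 := Int.lt_floor_add_one x
    have h3 := Int.le_ceil y
    have h4 := Int.ceil_lt_add_one y
    obtain ⟨m, hm⟩ : ∃ m : ℕ, ⌈y⌉ = ⌊x⌋ + m := by
      refine ⟨(⌈y⌉ - ⌊x⌋).toNat, ?_⟩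
      have : (⌊x⌋ : ℝ) ≤ ⌈y⌉ := by linarith
      have : ⌊x⌋ ≤ ⌈y⌉ := by exact_mod_cast this
      omega
    have hm' : (⌈y⌉ : ℝ) = ⌊x⌋ + m := by exact_mod_cast hm
    have := (hf.steps_bounds hinf hmono hφ ⌊x⌋ m).2
    rw [← hm'] at this
    have a1 : φ ⌊x⌋ ≤ φ x := hmono.monotone h1
    have a2 : φ y ≤ φ ⌈y⌉ := hmono.monotone h3
    have hmt : (m : ℝ) ≤ 9 * t := by linarith
    calc φ y - φ x ≤ m * K := by linarith
      _ ≤ 9 * t * K := by gcongr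
      _ = 9 * K * t := by ring

/-! ### Bounded cross ratios for images of harmonic quadruples. -/

/-- The cross ratio of the four points is at most `M`, and so is its inverse. -/
def CrossBounded (M : ℝ) (a b c d : Bdry) : Prop :=
  |wedge a b * wedge c d| ≤ M * |wedge b c * wedge d a| ∧
    |wedge b c * wedge d a| ≤ M * |wedge a b * wedge c d|

lemma CrossBounded.rotate {M : ℝ} {a b c d : Bdry} (h : CrossBounded M a b c d) :
    CrossBounded M b c d a := by
  refine ⟨h.2.trans_eq ?_, h.1.trans_eq' ?_⟩
  · rw [mul_comm (wedge c d)]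
  · rw [mul_comm (wedge c d)]

lemma CrossBounded.of_mob {M : ℝ} {p q r s : ℝ} (hA : p * s - q * r = 1) {a b c d : Bdry}
    (h : CrossBounded M (mob p q r s a) (mob p q r s b) (mob p q r s c) (mob p q r s d)) :
    CrossBounded M a b c d := by
  obtain ⟨l, hl, hw⟩ := exists_wedge_mob hA
  have e1 : |wedge a b * wedge c d| = |l a * l b * l c * l d| *
      |wedge (mob p q r s a) (mob p q r s b) * wedge (mob p q r s c) (mob p q r s d)| := by
    rw [← abs_mul, hw a b, hw c d]; congr 1; ring
  have e2 : |wedge b c * wedge d a| = |l a * l b * l c * l d| *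
      |wedge (mob p q r s b) (mob p q r s c) * wedge (mob p q r s d) (mob p q r s a)| := by
    rw [← abs_mul, hw b c, hw d a]; congr 1; ring
  unfold CrossBounded
  rw [e1, e2]
  constructor
  · rw [mul_left_comm]; exact mul_le_mul_of_nonneg_left h.1 (abs_nonneg _)
  · rw [mul_left_comm]; exact mul_le_mul_of_nonneg_left h.2 (abs_nonneg _)

/-- Here `w`, `v`, `u` are consecutive gaps between four points on the line. Two of them are
comparable to t, while the outer gap `w` is only bounded below; a large `w` is harmless, since it
occurs on both sides. -/
lemma crossBounded_aux {c C t M w u v : ℝ} (hc : 0 < c) (hC : 0 < C) (ht : 0 < t)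
    (hM : M = C / c * (1 + 2 * (C / c)))
    (hu : c * t ≤ u ∧ u ≤ C * t) (hv : c * t ≤ v ∧ v ≤ C * t) (hw : c * t ≤ w) :
    w * u ≤ M * (v * (w + v + u)) ∧ v * (w + v + u) ≤ M * (w * u) ∧ u ≤ M * v := by
  set R := C / c
  have hR : C = R * c := by simp only [R]; field_simp
  have hct : 0 < c * t := by positivity
  have hR1 : 1 ≤ R := by
    have : c * t ≤ C * t := hu.1.trans hu.2
    have := le_of_mul_le_mul_right this ht
    simp only [R]; rw [le_div_iff₀ hc]; linarith
  have hCt : C * t = R * (c * t) := by rw [hR]; ring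
  rw [hCt] at hu hv
  generalize c * t = k at *
  have huv : u ≤ R * v := hu.2.trans (by nlinarith)
  have hvu : v ≤ R * u := hv.2.trans (by nlinarith)
  have hw' : w + v + u ≤ (1 + 2 * R) * w := by nlinarith
  have hRM : R ≤ M := by rw [hM]; nlinarith
  have hu0 : 0 < u := by linarith
  have hv0 : 0 < v := by linarith
  have hw0 : 0 < w := by linarith
  have hM0 : 0 < M := by linarith
  refine ⟨?_, ?_, huv.trans (by gcongr)⟩
  · calc w * u ≤ w * (R * v) := by gcongr
      _ ≤ w * (M * v) := by gcongr
      _ ≤ (w + v + u) * (M * v) := by gcongr; linarith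
      _ = _ := by ring
  · calc v * (w + v + u) ≤ (R * u) * ((1 + 2 * R) * w) := by gcongr
      _ = M * (w * u) := by rw [hM]; ring

/-- The products are the denominators of the gaps of a harmonic quadruple. The factors 2 and 6 match
the lengths t/2 and 6t of `fareyBounded_two_sided`. -/
lemma crossBounded_products {y1 y2 : ℝ} (hy2 : 0 < y2) (ha : -y2 ≤ 2 * y1) (hb : 2 * y1 ≤ y2) :
    (y2 * (y2 - y1) ≤ 2 * (y1 ^ 2 + y2 ^ 2) ∧ y1 ^ 2 + y2 ^ 2 ≤ 6 * (y2 * (y2 - y1))) ∧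
    (y2 * (y1 + y2) ≤ 2 * (y1 ^ 2 + y2 ^ 2) ∧ y1 ^ 2 + y2 ^ 2 ≤ 6 * (y2 * (y1 + y2))) ∧
    y1 * (y1 + y2) ≤ 2 * (y1 ^ 2 + y2 ^ 2) ∧ -y1 * (y2 - y1) ≤ 2 * (y1 ^ 2 + y2 ^ 2) := by
  have h1 : 0 ≤ (y2 - 2 * y1) * (y2 + 2 * y1) := mul_nonneg (by linarith) (by linarith)
  have h2 : 0 ≤ y2 * (y2 - 2 * y1) := mul_nonneg hy2.le (by linarith)
  have h3 : 0 ≤ y2 * (y2 + 2 * y1) := mul_nonneg hy2.le (by linarith)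
  have h4 := sq_nonneg (y1 + y2)
  have h5 := sq_nonneg (y1 - y2)
  have h6 := sq_nonneg y1
  refine ⟨⟨?_, ?_⟩, ⟨?_, ?_⟩, ?_, ?_⟩ <;> linarith

/-- The diagonals of the quadruple meet at height t = δ/n, where δ is the determinant and n = y1² +
y2². If 2|y1| ≤ |y2|, then x1/y1 is the point far out, possibly infinity, and the other three points
are spaced by gaps comparable to t. -/
lemma crossBounded_of_small (K : ℝ) (hK : 1 ≤ K) : ∃ M : ℝ, 0 < M ∧
    ∀ f : Bdry → Bdry, FareyBounded K f → f OnePoint.infty = OnePoint.infty →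
      ∀ x1 y1 x2 y2 : ℝ, 0 < x1 * y2 - x2 * y1 →
        3 * (y1 ^ 2 + y2 ^ 2) ^ 2 ≤ 4 * (x1 * y2 - x2 * y1) ^ 2 → 2 * |y1| ≤ |y2| →
        CrossBounded M (f (ofVec x1 y1)) (f (ofVec (x1 + x2) (y1 + y2))) (f (ofVec x2 y2))
          (f (ofVec (x2 - x1) (y2 - y1))) := by
  obtain ⟨c, C, hc, hC, H⟩ := fareyBounded_two_sided K hK
  refine ⟨C / c * (1 + 2 * (C / c)), by positivity, ?_⟩
  intro f hf hinf
  obtain ⟨φ, hmono, hφ⟩ := hf.exists_real hinf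
  have H := H f φ hf hinf hmono hφ
  have main : ∀ x1 y1 x2 y2 : ℝ, 0 < y2 → 0 < x1 * y2 - x2 * y1 →
        3 * (y1 ^ 2 + y2 ^ 2) ^ 2 ≤ 4 * (x1 * y2 - x2 * y1) ^ 2 → 2 * |y1| ≤ y2 →
        CrossBounded (C / c * (1 + 2 * (C / c))) (f (ofVec x1 y1))
          (f (ofVec (x1 + x2) (y1 + y2))) (f (ofVec x2 y2))
          (f (ofVec (x2 - x1) (y2 - y1))) := by
    intro x1 y1 x2 y2 hy2 hδ hn hy
    have hy1 : -y2 ≤ 2 * y1 ∧ 2 * y1 ≤ y2 := by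
      rw [← abs_le, abs_mul, abs_two]; exact hy
    obtain ⟨hya, hyb⟩ := hy1
    have hp : 0 < y1 + y2 := by linarith
    have hm : 0 < y2 - y1 := by linarith
    have hnn : 0 < y1 ^ 2 + y2 ^ 2 := by positivity
    set δ := x1 * y2 - x2 * y1 with hδdef
    set n := y1 ^ 2 + y2 ^ 2 with hndef
    obtain ⟨⟨p1, p2⟩, ⟨p3, p4⟩, p5, p6⟩ := crossBounded_products hy2 hya hyb
    rw [← hndef] at p1 p2 p3 p4 p5 p6
    have ht : 0 < δ / n := by positivity
    have ht2 : 3 ≤ 4 * (δ / n) ^ 2 := by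
      rw [div_pow, mul_div_assoc', le_div_iff₀ (by positivity)]; exact hn
    have H := H (δ / n) ht ht2
    rw [ofVec_of_ne hp.ne', ofVec_of_ne hy2.ne', ofVec_of_ne hm.ne', hφ, hφ, hφ]
    set A := (x2 - x1) / (y2 - y1) with hA
    set B := x2 / y2 with hB
    set D := (x1 + x2) / (y1 + y2) with hD
    have hBA : B - A = δ / (y2 * (y2 - y1)) := by
      rw [hA, hB, hδdef]; field_simp; ring
    have hDB : D - B = δ / (y2 * (y1 + y2)) := by
      rw [hD, hB, hδdef]; field_simp; ring
    have lower : ∀ k : ℝ, 0 < k → k ≤ 2 * n → δ / n / 2 ≤ δ / k := by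
      intro k hk hkn
      rw [div_div]
      gcongr
      linarith
    have upper : ∀ k : ℝ, n ≤ 6 * k → δ / k ≤ 6 * (δ / n) := by
      intro k hkn
      have hk : 0 < k := by linarith
      rw [mul_div_assoc', div_le_div_iff₀ hk hnn]
      nlinarith
    have b1 := (H A B).1 (by rw [hBA]; exact lower _ (by positivity) p1)
    have b2 := (H A B).2 (by rw [hBA]; exact upper _ p2)
    have b3 := (H B D).1 (by rw [hDB]; exact lower _ (by positivity) p3)
    have b4 := (H B D).2 (by rw [hDB]; exact upper _ p4)
    have hct : 0 < c * (δ / n) := by positivity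
    -- The far point lies to the left of the other three, at infinity, or to their right.
    rcases lt_trichotomy y1 0 with h1 | h1 | h1
    · rw [ofVec_of_ne h1.ne, hφ]
      set E := x1 / y1 with hE
      have hAE : A - E = δ / (-y1 * (y2 - y1)) := by
        rw [hA, hE, hδdef]
        have := h1.ne
        field_simp
        ring
      have hpos : 0 < -y1 * (y2 - y1) := mul_pos (by linarith) hm
      have b5 := (H E A).1 (by rw [hAE]; exact lower _ hpos p6)
      have key := crossBounded_aux hc hC ht rfl (w := φ A - φ E) (u := φ D - φ B)
        (v := φ B - φ A) ⟨b3, b4⟩ ⟨b1, b2⟩ b5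
      simp only [CrossBounded, wedge_coe_coe]
      have f1 : |(φ E - φ D) * (φ B - φ A)| = (φ B - φ A) *
          (φ A - φ E + (φ B - φ A) + (φ D - φ B)) := by
        rw [abs_mul, abs_of_neg (by linarith : φ E - φ D < 0),
          abs_of_pos (by linarith : 0 < φ B - φ A)]; ring
      have f2 : |(φ D - φ B) * (φ A - φ E)| = (φ A - φ E) * (φ D - φ B) := by
        rw [abs_mul, abs_of_pos (by linarith : 0 < φ D - φ B),
          abs_of_pos (by linarith : 0 < φ A - φ E)]; ring
      rw [f1, f2]
      exact ⟨key.2.1, key.1⟩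
    · rw [h1, ofVec_zero, hinf]
      have k1 := crossBounded_aux hc hC ht rfl ⟨b1, b2⟩ ⟨b3, b4⟩ le_rfl
      have k2 := crossBounded_aux hc hC ht rfl ⟨b3, b4⟩ ⟨b1, b2⟩ le_rfl
      simp only [CrossBounded, wedge_infty_coe, wedge_coe_infty, wedge_coe_coe, one_mul, mul_neg,
        mul_one, abs_neg]
      rw [abs_of_pos (by linarith : 0 < φ B - φ A), abs_of_pos (by linarith : 0 < φ D - φ B)]
      exact ⟨k1.2.2, k2.2.2⟩
    · rw [ofVec_of_ne h1.ne', hφ]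
      set E := x1 / y1 with hE
      have hED : E - D = δ / (y1 * (y1 + y2)) := by
        rw [hD, hE, hδdef]
        field_simp
        ring
      have b5 := (H D E).1 (by rw [hED]; exact lower _ (by positivity) p5)
      have key := crossBounded_aux hc hC ht rfl (w := φ E - φ D) (u := φ B - φ A)
        (v := φ D - φ B) ⟨b1, b2⟩ ⟨b3, b4⟩ b5
      simp only [CrossBounded, wedge_coe_coe]
      have f1 : |(φ E - φ D) * (φ B - φ A)| = (φ E - φ D) * (φ B - φ A) := by
        rw [abs_of_pos (mul_pos (by linarith) (by linarith))]
      have f2 : |(φ D - φ B) * (φ A - φ E)| = (φ D - φ B) *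
          (φ E - φ D + (φ D - φ B) + (φ B - φ A)) := by
        rw [abs_mul, abs_of_pos (by linarith : 0 < φ D - φ B),
          abs_of_neg (by linarith : φ A - φ E < 0)]; ring
      rw [f1, f2]
      exact ⟨key.1, key.2.1⟩
  intro x1 y1 x2 y2 hδ hn hy
  rcases lt_trichotomy y2 0 with h2 | h2 | h2
  -- Negating both vectors changes neither the points nor the determinant.
  · have := main (-1 * x1) (-1 * y1) (-1 * x2) (-1 * y2) (by linarith) (by linarith)
      (by convert hn using 2 <;> ring) (by simpa [abs_of_neg h2] using hy)
    have h10 : (-1 : ℝ) ≠ 0 := by norm_num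
    rwa [← mul_add, ← mul_add, ← mul_sub, ← mul_sub, ofVec_smul h10, ofVec_smul h10,
      ofVec_smul h10, ofVec_smul h10] at this
  · subst h2
    have : y1 = 0 := by
      rw [abs_zero] at hy
      exact abs_eq_zero.1 (le_antisymm (by linarith) (abs_nonneg _))
    subst this
    simp at hδ
  · exact main x1 y1 x2 y2 h2 hδ hn (by rwa [abs_of_pos h2] at hy)

/-- Rotating the labels of the quadruple replaces (v1, v2) by another pair, such as (v1 + v2, v2 -
v1), and preserves the height δ/n. So any of the four points may play the part of the far one. -/
lemma crossBounded_of_fixed (K : ℝ) (hK : 1 ≤ K) : ∃ M : ℝ, 0 < M ∧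
    ∀ f : Bdry → Bdry, FareyBounded K f → f OnePoint.infty = OnePoint.infty →
      ∀ x1 y1 x2 y2 : ℝ, 0 < x1 * y2 - x2 * y1 →
        3 * (y1 ^ 2 + y2 ^ 2) ^ 2 ≤ 4 * (x1 * y2 - x2 * y1) ^ 2 →
        CrossBounded M (f (ofVec x1 y1)) (f (ofVec (x1 + x2) (y1 + y2))) (f (ofVec x2 y2))
          (f (ofVec (x2 - x1) (y2 - y1))) := by
  obtain ⟨M, hM, H⟩ := crossBounded_of_small K hK
  refine ⟨M, hM, fun f hf hinf x1 y1 x2 y2 hδ hn => ?_⟩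
  have H := H f hf hinf
  have h2 : (2 : ℝ) ≠ 0 := two_ne_zero
  have h1 : (-1 : ℝ) ≠ 0 := by norm_num
  have hneg : ∀ u v : ℝ, ofVec (-u) (-v) = ofVec u v := fun u v => by
    rw [← ofVec_smul h1 u v]; simp
  have hswap : ofVec (x1 - x2) (y1 - y2) = ofVec (x2 - x1) (y2 - y1) := by
    rw [← hneg]; simp
  have e1 : ofVec (x1 + x1) (y1 + y1) = ofVec x1 y1 := by
    rw [← ofVec_smul h2 x1, two_mul, two_mul]
  have e2 : ofVec (x2 + x2) (y2 + y2) = ofVec x2 y2 := by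
    rw [← ofVec_smul h2 x2, two_mul, two_mul]
  -- The four double cones about the axes and the diagonals cover the (y1, y2)-plane: their
  -- half-angle arctan(1/2) exceeds π/8.
  have hcases : 2 * |y1| ≤ |y2| ∨ 2 * |y2| ≤ |y1| ∨ 2 * |y1 - y2| ≤ |y1 + y2| ∨
      2 * |y1 + y2| ≤ |y2 - y1| := by
    rcases abs_cases y1 with ⟨a1, b1⟩ | ⟨a1, b1⟩ <;> rcases abs_cases y2 with ⟨a2, b2⟩ | ⟨a2, b2⟩ <;>
      rcases abs_cases (y1 - y2) with ⟨a3, b3⟩ | ⟨a3, b3⟩ <;>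
      rcases abs_cases (y1 + y2) with ⟨a4, b4⟩ | ⟨a4, b4⟩ <;>
      rw [abs_sub_comm y2 y1, a1, a2, a3, a4] <;> by_contra! hcon <;>
      obtain ⟨c1, c2, c3, c4⟩ := hcon <;> linarith
  rcases hcases with h | h | h | h
  · exact H x1 y1 x2 y2 hδ hn h
  · have := H x2 y2 (-x1) (-y1) (by linarith) (by convert hn using 2 <;> ring) (by rwa [abs_neg])
    rw [hneg, ← sub_eq_add_neg, ← sub_eq_add_neg,
      show -x1 - x2 = -(x1 + x2) by ring, show -y1 - y2 = -(y1 + y2) by ring, hneg] at this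
    exact this.rotate.rotate
  · have := H (x1 - x2) (y1 - y2) (x1 + x2) (y1 + y2) (by linarith)
      (by
        have : 4 * (3 * (y1 ^ 2 + y2 ^ 2) ^ 2) ≤ 4 * (4 * (x1 * y2 - x2 * y1) ^ 2) := by linarith
        convert this using 1 <;> ring) h
    rw [show x1 - x2 + (x1 + x2) = x1 + x1 by ring, show y1 - y2 + (y1 + y2) = y1 + y1 by ring,
      show x1 + x2 - (x1 - x2) = x2 + x2 by ring, show y1 + y2 - (y1 - y2) = y2 + y2 by ring,
      e1, e2, hswap] at this
    exact this.rotate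
  · have := H (x1 + x2) (y1 + y2) (x2 - x1) (y2 - y1) (by linarith)
      (by
        have : 4 * (3 * (y1 ^ 2 + y2 ^ 2) ^ 2) ≤ 4 * (4 * (x1 * y2 - x2 * y1) ^ 2) := by linarith
        convert this using 1 <;> ring) h
    rw [show x1 + x2 + (x2 - x1) = x2 + x2 by ring, show y1 + y2 + (y2 - y1) = y2 + y2 by ring,
      show x2 - x1 - (x1 + x2) = -(x1 + x1) by ring, show y2 - y1 - (y1 + y2) = -(y1 + y1) by ring,
      hneg, e1, e2] at this
    exact this.rotate.rotate.rotate

-- The point z = (x1 - i x2)/(y1 - i y2) is where the diagonals of the harmonic quadruple cross.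
-- Moving it into the standard fundamental domain of the modular group makes its height at least
-- √3/2.
open UpperHalfPlane in
lemma exists_sl_small {x1 y1 x2 y2 : ℝ} (hδ : 0 < x1 * y2 - x2 * y1) :
    ∃ p q r s : ℤ, p * s - q * r = 1 ∧
      3 * ((r * x1 + s * y1) ^ 2 + (r * x2 + s * y2) ^ 2) ^ 2 ≤ 4 * (x1 * y2 - x2 * y1) ^ 2 := by
  have hn : 0 < y1 ^ 2 + y2 ^ 2 := by
    by_contra! h
    have h1 : y1 = 0 := by nlinarith [sq_nonneg y1, sq_nonneg y2]
    have h2 : y2 = 0 := by nlinarith [sq_nonneg y1, sq_nonneg y2]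
    simp [h1, h2] at hδ
  let z : ℍ := ⟨⟨(x1 * y1 + x2 * y2) / (y1 ^ 2 + y2 ^ 2),
    (x1 * y2 - x2 * y1) / (y1 ^ 2 + y2 ^ 2)⟩, div_pos hδ hn⟩
  obtain ⟨g, hg⟩ := ModularGroup.exists_smul_mem_fd z
  have him := ModularGroup.three_le_four_mul_im_sq_of_mem_fd hg
  rw [ModularGroup.im_smul_eq_div_normSq] at him
  refine ⟨g 0 0, g 0 1, g 1 0, g 1 1, ?_, ?_⟩
  · have := g.det_coe
    rwa [Matrix.det_fin_two] at this
  have hz : z.im = (x1 * y2 - x2 * y1) / (y1 ^ 2 + y2 ^ 2) := rfl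
  have hzr : z.re = (x1 * y1 + x2 * y2) / (y1 ^ 2 + y2 ^ 2) := rfl
  have hd : Complex.normSq (denom g z) = ((g 1 0 * x1 + g 1 1 * y1) ^ 2 +
      (g 1 0 * x2 + g 1 1 * y2) ^ 2) / (y1 ^ 2 + y2 ^ 2) := by
    rw [ModularGroup.denom_apply, Complex.normSq_apply]
    simp only [Complex.add_re, Complex.mul_re, Complex.intCast_re, Complex.intCast_im, zero_mul,
      sub_zero, Complex.add_im, Complex.mul_im, add_zero, UpperHalfPlane.coe_re,
      UpperHalfPlane.coe_im, hz, hzr]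
    field_simp
    ring
  have hpos := UpperHalfPlane.normSq_denom_pos (g : GL (Fin 2) ℝ) z.im_ne_zero
  rw [hd] at hpos him
  rw [hz, div_div_div_cancel_right₀ hn.ne'] at him
  have hpos' := (div_pos_iff_of_pos_right hn).1 hpos
  rw [div_pow, mul_div_assoc', le_div_iff₀ (by positivity)] at him
  exact him

theorem crossBounded_of_fareyBounded (K : ℝ) (hK : 1 ≤ K) : ∃ M : ℝ, 0 < M ∧
    ∀ f : Bdry → Bdry, FareyBounded K f → ∀ x1 y1 x2 y2 : ℝ, 0 < x1 * y2 - x2 * y1 →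
        CrossBounded M (f (ofVec x1 y1)) (f (ofVec (x1 + x2) (y1 + y2))) (f (ofVec x2 y2))
          (f (ofVec (x2 - x1) (y2 - y1))) := by
  obtain ⟨M, hM, H⟩ := crossBounded_of_fixed K hK
  refine ⟨M, hM, fun f hf x1 y1 x2 y2 hδ => ?_⟩
  obtain ⟨p, q, r, s, hA, hsmall⟩ := exists_sl_small hδ
  have hA' : (p : ℝ) * s - q * r = 1 := by exact_mod_cast hA
  -- Write f = (f ∘ A⁻¹) ∘ A: the matrix A lifts the quadruple, and f ∘ A⁻¹ is again Farey-bounded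
  -- with the same constant.
  have hf' : FareyBounded K fun x => f (mob s (-q) (-r) p x) := by
    have := hf.comp_mob (p := s) (q := -q) (r := -r) (s := p) (by linarith)
    simpa using this
  have h01 : intDet OnePoint.infty ((0 : ℤ) : ℝ) = 1 := by
    rw [intDet_comm, intDet_coe_infty, den_intCast]; simp
  obtain ⟨p', q', r', s', hB, hBinf⟩ :=
    exists_mob_eq_infty (den_left_ne_zero (hf'.bound _ _ h01).1)
  have hf'' := hf'.mob_comp hB
  have hdet : (p * x1 + q * y1) * (r * x2 + s * y2) - (p * x2 + q * y2) * (r * x1 + s * y1) =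
      x1 * y2 - x2 * y1 := by
    linear_combination (x1 * y2 - x2 * y1) * hA'
  have := H _ hf'' hBinf (p * x1 + q * y1) (r * x1 + s * y1) (p * x2 + q * y2) (r * x2 + s * y2)
    (by rwa [hdet]) (by rwa [hdet])
  have hB' : (p' : ℝ) * s' - q' * r' = 1 := by exact_mod_cast hB
  have := this.of_mob hB'
  rw [show p * x1 + q * y1 + (p * x2 + q * y2) = p * (x1 + x2) + q * (y1 + y2) by ring,
    show r * x1 + s * y1 + (r * x2 + s * y2) = r * (x1 + x2) + s * (y1 + y2) by ring,
    show p * x2 + q * y2 - (p * x1 + q * y1) = p * (x2 - x1) + q * (y2 - y1) by ring,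
    show r * x2 + s * y2 - (r * x1 + s * y1) = r * (x2 - x1) + s * (y2 - y1) by ring] at this
  have nz : ∀ u v u' v' : ℝ, u * v' - u' * v ≠ 0 → u ≠ 0 ∨ v ≠ 0 := by
    intro u v u' v' h
    by_contra! hc
    simp [hc.1, hc.2] at h
  rw [← mob_ofVec (nz x1 y1 x2 y2 hδ.ne'),
    ← mob_ofVec (nz (x1 + x2) (y1 + y2) x2 y2 (by ring_nf; linarith)),
    ← mob_ofVec (nz x2 y2 x1 y1 (by linarith)),
    ← mob_ofVec (nz (x2 - x1) (y2 - y1) x2 y2 (by ring_nf; linarith))] at this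
  simpa only [mob_mob_inv hA'] using this

end IdealTri

namespace IdealTri
open Real

/-! ### Arc lengths and chords on the unit circle. -/

lemma angle_injective : Function.Injective angle := by
  intro x y h
  induction x using OnePoint.rec with
  | infty =>
    induction y using OnePoint.rec with
    | infty => rfl
    | coe t => exact absurd h (angle_coe_lt_pi t).ne'
  | coe s =>
    induction y using OnePoint.rec with
    | infty => exact absurd h (angle_coe_lt_pi s).ne
    | coe t =>
      rw [angle_coe, angle_coe] at h
      rw [arctan_injective (mul_left_cancel₀ two_ne_zero h)]

lemma exists_angle_eq {t : ℝ} (h1 : -π < t) (h2 : t ≤ π) : ∃ x : Bdry, angle x = t := by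
  rcases h2.lt_or_eq with h | rfl
  · refine ⟨((tan (t / 2) : ℝ) : Bdry), ?_⟩
    rw [angle_coe, arctan_tan (by linarith) (by linarith)]
    ring
  · exact ⟨OnePoint.infty, rfl⟩

lemma arcLength_nonneg (a b : Bdry) : 0 ≤ arcLength a b := by
  unfold arcLength
  have := neg_pi_lt_angle b
  have := angle_le_pi a
  split_ifs <;> linarith

lemma arcLength_lt (a b : Bdry) : arcLength a b < 2 * π := by
  unfold arcLength
  have := neg_pi_lt_angle a
  have := angle_le_pi b
  split_ifs <;> linarith

lemma arcLength_self (a : Bdry) : arcLength a a = 0 := by simp [arcLength]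

lemma arcLength_pos {a b : Bdry} (h : a ≠ b) : 0 < arcLength a b := by
  have h' : angle a ≠ angle b := fun e => h (angle_injective e)
  have := neg_pi_lt_angle b
  have := angle_le_pi a
  unfold arcLength
  split_ifs with hc
  · have := lt_of_le_of_ne hc h'
    linarith
  · linarith

lemma ne_of_arcLength_pos {a b : Bdry} (h : 0 < arcLength a b) : a ≠ b := by
  rintro rfl
  simp [arcLength_self] at h

lemma arcLength_add_swap {a b : Bdry} (h : a ≠ b) : arcLength a b + arcLength b a = 2 * π := by
  have h' : angle a ≠ angle b := fun e => h (angle_injective e)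
  unfold arcLength
  split_ifs with h1 h2
  · exact absurd (le_antisymm h1 h2) h'
  · ring
  · ring
  · linarith

lemma PosOrder.arcLength_add {a b c : Bdry} (h : PosOrder a b c) :
    arcLength a b + arcLength b c = arcLength a c := by
  unfold arcLength
  rcases h with h | h | h <;> split_ifs <;> linarith [h.1, h.2]

lemma posOrder_of_arcLength {a b c : Bdry} (hab : a ≠ b) (hbc : b ≠ c)
    (h : arcLength a b + arcLength b c < 2 * π) : PosOrder a b c := by
  have h1 : angle a ≠ angle b := fun e => hab (angle_injective e)
  have h2 : angle b ≠ angle c := fun e => hbc (angle_injective e)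
  unfold arcLength at h
  unfold PosOrder
  split_ifs at h with h3 h4 h4
  · exact Or.inl ⟨lt_of_le_of_ne h3 h1, lt_of_le_of_ne h4 h2⟩
  · exact Or.inr (Or.inr ⟨by linarith, lt_of_le_of_ne h3 h1⟩)
  · exact Or.inr (Or.inl ⟨lt_of_le_of_ne h4 h2, by linarith⟩)
  · exfalso
    have := neg_pi_lt_angle c
    have := angle_le_pi a
    linarith

lemma posOrder_of_arcLength_lt {a b c : Bdry} (hab : a ≠ b)
    (h : arcLength a b < arcLength a c) : PosOrder a b c := by
  have h1 : angle a ≠ angle b := fun e => hab (angle_injective e)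
  have := neg_pi_lt_angle c
  have := angle_le_pi b
  unfold arcLength at h
  unfold PosOrder
  split_ifs at h with h3 h4 h4
  · exact Or.inl ⟨lt_of_le_of_ne h3 h1, by linarith⟩
  · exact Or.inr (Or.inr ⟨by linarith, lt_of_le_of_ne h3 h1⟩)
  · exfalso
    have := neg_pi_lt_angle b
    have := angle_le_pi c
    linarith
  · exact Or.inr (Or.inl ⟨by linarith, by linarith⟩)

lemma exists_arcLength_right (a : Bdry) {t : ℝ} (h0 : 0 ≤ t) (h1 : t < 2 * π) :
    ∃ b, arcLength a b = t := by
  have ha := neg_pi_lt_angle a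
  have ha' := angle_le_pi a
  rcases le_or_gt (angle a + t) π with h | h
  · obtain ⟨b, hb⟩ := exists_angle_eq (t := angle a + t) (by linarith) h
    refine ⟨b, ?_⟩
    rw [arcLength, if_pos (by linarith), hb]; ring
  · obtain ⟨b, hb⟩ := exists_angle_eq (t := angle a + t - 2 * π) (by linarith) (by linarith)
    refine ⟨b, ?_⟩
    rw [arcLength, if_neg (by linarith), hb]; ring

lemma exists_arcLength_left (b : Bdry) {t : ℝ} (h0 : 0 ≤ t) (h1 : t < 2 * π) :
    ∃ a, arcLength a b = t := by
  have ha := neg_pi_lt_angle b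
  have ha' := angle_le_pi b
  rcases lt_or_ge (-π) (angle b - t) with h | h
  · obtain ⟨a, hb⟩ := exists_angle_eq (t := angle b - t) h (by linarith)
    refine ⟨a, ?_⟩
    rw [arcLength, if_pos (by linarith), hb]; ring
  · obtain ⟨a, hb⟩ := exists_angle_eq (t := angle b - t + 2 * π) (by linarith) (by linarith)
    refine ⟨a, ?_⟩
    rw [arcLength, if_neg (by linarith), hb]; ring

/-- Half the Euclidean distance of two points of the unit circle. -/
noncomputable def chord (x y : Bdry) : ℝ := |sin ((angle x - angle y) / 2)|

lemma chord_comm (x y : Bdry) : chord x y = chord y x := by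
  rw [chord, chord, ← abs_neg, ← sin_neg]; congr 2; ring

lemma chord_nonneg (x y : Bdry) : 0 ≤ chord x y := abs_nonneg _

lemma chord_le_one (x y : Bdry) : chord x y ≤ 1 := abs_sin_le_one _

lemma chord_triangle (x y z : Bdry) : chord x z ≤ chord x y + chord y z := by
  unfold chord
  rw [show (angle x - angle z) / 2 = (angle x - angle y) / 2 + (angle y - angle z) / 2 by ring,
    sin_add]
  refine (abs_add_le _ _).trans ?_
  rw [abs_mul, abs_mul]
  gcongr
  · exact mul_le_of_le_one_right (abs_nonneg _) (abs_cos_le_one _)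
  · exact mul_le_of_le_one_left (abs_nonneg _) (abs_cos_le_one _)

lemma sin_half_arcLength (x y : Bdry) : sin (arcLength x y / 2) = chord x y := by
  have h1 := neg_pi_lt_angle x
  have h2 := neg_pi_lt_angle y
  have h3 := angle_le_pi x
  have h4 := angle_le_pi y
  rw [chord_comm]
  unfold arcLength chord
  split_ifs with h
  · rw [abs_of_nonneg]
    exact sin_nonneg_of_nonneg_of_le_pi (by linarith) (by linarith)
  · push Not at h
    rw [show (angle y - angle x + 2 * π) / 2 = (angle y - angle x) / 2 + π by ring, sin_add_pi,
      abs_of_nonpos]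
    exact sin_nonpos_of_nonpos_of_neg_pi_le (by linarith) (by linarith)

lemma exists_pos_scale (x : Bdry) : ∃ l : ℝ, 0 < l ∧ vecX x = l * sin (angle x / 2) ∧
    vecY x = l * cos (angle x / 2) := by
  induction x using OnePoint.rec with
  | infty => exact ⟨1, one_pos, by simp, by simp⟩
  | coe t =>
    have : 0 < √(1 + t ^ 2) := sqrt_pos.2 (by positivity)
    refine ⟨√(1 + t ^ 2), this, ?_, ?_⟩
    · rw [angle_coe, mul_div_cancel_left₀ _ two_ne_zero, sin_arctan, vecX_coe]
      field_simp
    · rw [angle_coe, mul_div_cancel_left₀ _ two_ne_zero, cos_arctan, vecY_coe]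
      field_simp

/-- Normalising homogeneous vectors to unit length turns determinants into chords, so cross ratios
may be computed with chords. -/
lemma exists_abs_wedge_eq : ∃ l : Bdry → ℝ, (∀ x, 0 < l x) ∧
    ∀ x y, |wedge x y| = l x * l y * chord x y := by
  choose l hl h1 h2 using exists_pos_scale
  refine ⟨l, hl, fun x y => ?_⟩
  rw [chord, wedge, h1 x, h1 y, h2 x, h2 y, sub_div, sin_sub]
  conv_rhs => rw [← abs_of_pos (mul_pos (hl x) (hl y)), ← abs_mul]
  congr 1
  ring

lemma chord_eq_zero {x y : Bdry} : chord x y = 0 ↔ x = y := by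
  obtain ⟨l, hl, hw⟩ := exists_abs_wedge_eq
  rw [← wedge_eq_zero, ← abs_eq_zero (a := wedge x y), hw]
  have := (hl x).ne'
  have := (hl y).ne'
  simp [*]

lemma CrossBounded.chord {M : ℝ} {a b c d : Bdry} (h : CrossBounded M a b c d) :
    chord a b * chord c d ≤ M * (chord b c * chord d a) ∧
      chord b c * chord d a ≤ M * (chord a b * chord c d) := by
  obtain ⟨l, hl, hw⟩ := exists_abs_wedge_eq
  have hpos : 0 < l a * l b * l c * l d :=
    mul_pos (mul_pos (mul_pos (hl a) (hl b)) (hl c)) (hl d)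
  obtain ⟨h1, h2⟩ := h
  simp only [abs_mul, hw] at h1 h2
  constructor
  · refine le_of_mul_le_mul_left ?_ hpos
    linarith
  · refine le_of_mul_le_mul_left ?_ hpos
    linarith

lemma ofVec_sin_cos_angle (x : Bdry) : ofVec (sin (angle x / 2)) (cos (angle x / 2)) = x := by
  obtain ⟨l, hl, h1, h2⟩ := exists_pos_scale x
  conv_rhs => rw [← ofVec_vec x, h1, h2]
  rw [ofVec_smul hl.ne']

lemma ofVec_sin_cos_sub_pi (t : ℝ) : ofVec (sin (t - π)) (cos (t - π)) =
    ofVec (sin t) (cos t) := by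
  rw [sin_sub_pi, cos_sub_pi, ← ofVec_smul (show (-1 : ℝ) ≠ 0 by norm_num) (sin t)]
  simp

/-- Homogeneous vectors turn at half the speed of the circle; a wrap by 2π only changes the sign of
the vector. -/
lemma eq_ofVec_add_arcLength (b c : Bdry) :
    c = ofVec (sin (angle b / 2 + arcLength b c / 2)) (cos (angle b / 2 + arcLength b c / 2)) := by
  conv_lhs => rw [← ofVec_sin_cos_angle c]
  unfold arcLength
  split_ifs with h
  · congr 2 <;> ring
  · rw [show angle b / 2 + (angle c - angle b + 2 * π) / 2 = angle c / 2 + π by ring,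
      ← ofVec_sin_cos_sub_pi (angle c / 2 + π), add_sub_cancel_right]

lemma eq_ofVec_sub_arcLength (a b : Bdry) :
    a = ofVec (sin (angle b / 2 - arcLength a b / 2)) (cos (angle b / 2 - arcLength a b / 2)) := by
  conv_lhs => rw [← ofVec_sin_cos_angle a]
  unfold arcLength
  split_ifs with h
  · congr 2 <;> ring
  · rw [← ofVec_sin_cos_sub_pi]
    congr 2 <;> ring

lemma two_mul_chord_le_arcLength (x y : Bdry) : 2 * chord x y ≤ arcLength x y := by
  rw [← sin_half_arcLength]
  have := sin_le (x := arcLength x y / 2) (by have := arcLength_nonneg x y; linarith)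
  linarith

/-- A chord controls its arc unless the arc is nearly the whole circle. That is excluded by a longer
arc whose chord is still at least `d`: beyond length π the chord decreases with the arc. -/
lemma mul_arcLength_le {d : ℝ} {x y z w : Bdry} (hd : 0 < d) (hd1 : d ≤ 1)
    (h : arcLength x y ≤ arcLength z w) (hc : d ≤ chord z w) :
    d * arcLength x y ≤ 2 * π * chord x y := by
  have h0 := arcLength_nonneg x y
  have hlt := arcLength_lt z w
  have hcn := chord_nonneg x y
  rcases le_or_gt (arcLength x y) π with hπ | hπ
  · have := mul_le_sin (x := arcLength x y / 2) (by linarith) (by linarith)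
    rw [sin_half_arcLength] at this
    have e : 2 / π * (arcLength x y / 2) = arcLength x y / π := by field_simp
    rw [e, div_le_iff₀ pi_pos] at this
    have : d * arcLength x y ≤ arcLength x y := mul_le_of_le_one_left h0 hd1
    nlinarith [pi_pos]
  · have h1 : sin (arcLength z w / 2) ≤ sin (arcLength x y / 2) := by
      rw [← sin_pi_sub (arcLength z w / 2), ← sin_pi_sub (arcLength x y / 2)]
      exact sin_le_sin_of_le_of_le_pi_div_two (by linarith) (by linarith) (by linarith)
    rw [sin_half_arcLength, sin_half_arcLength] at h1
    have := arcLength_lt x y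
    calc d * arcLength x y ≤ d * (2 * π) := by gcongr
      _ ≤ chord x y * (2 * π) := by gcongr; linarith
      _ = _ := by ring

/-- The angle itself jumps at infinity, so continuity of chords goes through the point of the unit
circle. -/
lemma continuous_exp_angle :
    Continuous fun x : Bdry => Complex.exp (Complex.I * (angle x : ℂ)) := by
  rw [OnePoint.continuous_iff]
  constructor
  · rw [Filter.coclosedCompact_eq_cocompact, cocompact_eq_atBot_atTop, Filter.tendsto_sup]
    have hc : Continuous fun t : ℝ => Complex.exp (Complex.I * ((2 * t : ℝ) : ℂ)) := by fun_prop
    have hneg : Complex.exp (Complex.I * ((2 * -(π / 2) : ℝ) : ℂ)) =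
        Complex.exp (Complex.I * ((angle OnePoint.infty : ℝ) : ℂ)) := by
      rw [Complex.exp_eq_exp_iff_exists_int]
      refine ⟨-1, ?_⟩
      rw [angle_infty]
      push_cast
      ring
    have hpos : Complex.exp (Complex.I * ((2 * (π / 2) : ℝ) : ℂ)) =
        Complex.exp (Complex.I * ((angle OnePoint.infty : ℝ) : ℂ)) := by
      rw [angle_infty]
      congr 3
      ring
    constructor
    · rw [← hneg]
      exact (hc.tendsto _).comp (tendsto_nhds_of_tendsto_nhdsWithin tendsto_arctan_atBot)
    · rw [← hpos]
      exact (hc.tendsto _).comp (tendsto_nhds_of_tendsto_nhdsWithin tendsto_arctan_atTop)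
  · simp only [angle_coe]
    fun_prop

lemma chord_eq_norm (x y : Bdry) :
    chord x y = ‖Complex.exp (Complex.I * (angle x : ℂ)) -
      Complex.exp (Complex.I * (angle y : ℂ))‖ / 2 := by
  have h : Complex.exp (Complex.I * (angle x : ℂ)) - Complex.exp (Complex.I * (angle y : ℂ)) =
      Complex.exp (Complex.I * (angle y : ℂ)) *
        (Complex.exp (Complex.I * ((angle x - angle y : ℝ) : ℂ)) - 1) := by
    rw [mul_sub, ← Complex.exp_add, mul_one]
    congr 2
    push_cast
    ring
  rw [h, norm_mul, mul_comm Complex.I (angle y : ℂ), Complex.norm_exp_ofReal_mul_I,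
    Complex.norm_exp_I_mul_ofReal_sub_one, chord]
  simp

lemma continuous_chord : Continuous fun p : Bdry × Bdry => chord p.1 p.2 := by
  simp only [chord_eq_norm]
  exact (((continuous_exp_angle.comp continuous_fst).sub
    (continuous_exp_angle.comp continuous_snd)).norm).div_const 2

lemma exists_chord_lower_bound (f : Bdry ≃ₜ Bdry) :
    ∃ d : ℝ, 0 < d ∧ d ≤ 1 ∧ ∀ x y, chord x y = 1 → d ≤ chord (f x) (f y) := by
  have hcl : IsClosed {p : Bdry × Bdry | chord p.1 p.2 = 1} :=
    isClosed_eq continuous_chord continuous_const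
  have hcont : Continuous fun p : Bdry × Bdry => chord (f p.1) (f p.2) := by
    have h := continuous_chord.comp (f.continuous.prodMap f.continuous)
    simpa only [Function.comp_def, Prod.map_fst, Prod.map_snd] using h
  have hne : {p : Bdry × Bdry | chord p.1 p.2 = 1}.Nonempty := by
    refine ⟨(OnePoint.infty, ((0 : ℝ) : Bdry)), ?_⟩
    change chord OnePoint.infty ((0 : ℝ) : Bdry) = 1
    rw [chord, angle_infty, angle_coe, arctan_zero, mul_zero, sub_zero, sin_pi_div_two, abs_one]
  obtain ⟨p, hp, hmin⟩ := hcl.isCompact.exists_isMinOn hne hcont.continuousOn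
  refine ⟨chord (f p.1) (f p.2), ?_, chord_le_one _ _, fun x y hxy => hmin (a := (x, y)) hxy⟩
  refine lt_of_le_of_ne (chord_nonneg _ _) fun h => ?_
  have := f.injective (chord_eq_zero.1 h.symm)
  have hp : chord p.1 p.2 = 1 := hp
  rw [chord_eq_zero.2 this] at hp
  exact zero_ne_one hp

end IdealTri

namespace IdealTri
open Real

/-! ### Farey-bounded homeomorphisms are quasisymmetric. -/

lemma ratio_bounds {M A B : ℝ} (hM : 0 < M) (hB : 0 < B) (h1 : A ≤ M * B)
    (h2 : B ≤ M * A) : 1 / M ≤ A / B ∧ A / B ≤ M :=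
  ⟨by rw [div_le_div_iff₀ hM hB]; linarith, by rwa [div_le_iff₀ hB]⟩

/-- Since `b` and `e` are far apart, `c` is at distance at least d/2 from one of them. Far from `b`,
the trivial bound 1 on chords suffices; far from `e`, the cross ratio bound does. -/
lemma chord_le_of_cross {M d : ℝ} (hM : 0 < M) (hd : 0 < d)
    {a b c e : Bdry} (hcr : chord a b * chord c e ≤ M * (chord b c * chord e a))
    (hbe : d ≤ chord b e) :
    chord a b ≤ (2 * (M + 1) / d) * chord b c := by
  have h1 := chord_triangle b c e
  have h2 := chord_le_one e a
  have h3 := chord_nonneg b c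
  have h4 := chord_nonneg e a
  have h5 := chord_le_one a b
  have h6 := chord_nonneg a b
  rw [div_mul_eq_mul_div, le_div_iff₀ hd]
  rcases le_or_gt (d / 2) (chord b c) with h | h
  · nlinarith
  · have h7 : d / 2 ≤ chord c e := by linarith
    nlinarith [mul_nonneg h3 h4, mul_le_mul_of_nonneg_left h2 h3]

theorem FareyBounded.quasisymmetric {K : ℝ} {f : Bdry ≃ₜ Bdry} (hf : FareyBounded K f) :
    Quasisymmetric f := by
  obtain ⟨M, hM, H⟩ := crossBounded_of_fareyBounded K hf.one_le
  obtain ⟨d, hd, hd1, hdist⟩ := exists_chord_lower_bound f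
  refine ⟨hf.mono, ?_⟩
  set M' := 2 * (M + 1) / d
  have hM' : 0 < M' := by positivity
  refine ⟨π / d * M', by positivity, ?_⟩
  intro a b c hab hl hlπ
  have hl0 := arcLength_pos hab
  have hbc : b ≠ c := ne_of_arcLength_pos (hl ▸ hl0)
  obtain ⟨e, he⟩ := exists_arcLength_right b (t := π) pi_pos.le (by linarith [pi_pos])
  have hbe : b ≠ e := ne_of_arcLength_pos (he ▸ pi_pos)
  have heb : arcLength e b = π := by linarith [arcLength_add_swap hbe]
  have hch : chord b e = 1 := by rw [← sin_half_arcLength, he, sin_pi_div_two]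
  have hdbe := hdist b e hch
  have hdeb : d ≤ chord (f e) (f b) := by rwa [chord_comm]
  have fab := f.injective.ne hab
  have fbc := f.injective.ne hbc
  have A1 : arcLength (f a) (f b) ≤ arcLength (f e) (f b) ∧
      arcLength (f b) (f c) ≤ arcLength (f b) (f e) := by
    rcases hlπ.lt_or_eq with hlt | heq
    · constructor
      · have hp : PosOrder a b e := posOrder_of_arcLength hab hbe (by linarith)
        have := (hf.mono _ _ _ hp).rotate.rotate.arcLength_add
        linarith [arcLength_nonneg (f e) (f a)]
      · have hp : PosOrder b c e := posOrder_of_arcLength_lt hbc (by linarith)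
        have := (hf.mono _ _ _ hp).arcLength_add
        linarith [arcLength_nonneg (f c) (f e)]
    -- Two arcs of length π fill the circle, so both outer endpoints are the antipode of `b`.
    · have h1 : a = e := by
        rw [eq_ofVec_sub_arcLength a b, eq_ofVec_sub_arcLength e b, heq, heb]
      have h2 : c = e := by
        rw [eq_ofVec_add_arcLength b c, eq_ofVec_add_arcLength b e, ← hl, heq, he]
      subst h1
      rw [h2]
      exact ⟨le_rfl, le_rfl⟩
  have B1 := mul_arcLength_le hd hd1 A1.1 hdeb
  have B2 := mul_arcLength_le hd hd1 A1.2 hdbe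
  have C : chord (f a) (f b) ≤ M' * chord (f b) (f c) ∧
      chord (f b) (f c) ≤ M' * chord (f a) (f b) := by
    rcases hlπ.lt_or_eq with hlt | heq
    · have s1 : 0 < sin (arcLength a b / 2) := sin_pos_of_pos_of_lt_pi (by linarith) (by linarith)
      have s2 : 0 < cos (arcLength a b / 2) :=
        cos_pos_of_mem_Ioo ⟨by linarith, by linarith⟩
      set β := angle b / 2 with hβ
      set α := arcLength a b / 2 with hα
      -- Take v1 = sin α · e and v2 = cos α · b with unit vectors for `e` and `b`; the addition
      -- formulas make v1 + v2 and v2 - v1 the unit vectors of `c` and `a`.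
      have key := H f hf (sin α * cos β) (sin α * -sin β) (cos α * sin β) (cos α * cos β)
        (by
          have : sin α * cos β * (cos α * cos β) - cos α * sin β * (sin α * -sin β) =
            sin α * cos α := by linear_combination sin α * cos α * sin_sq_add_cos_sq β
          rw [this]; positivity)
      have pe : ofVec (sin α * cos β) (sin α * -sin β) = e := by
        rw [ofVec_smul s1.ne', eq_ofVec_add_arcLength b e, he, ← hβ, sin_add_pi_div_two,
          cos_add_pi_div_two]
      have pc : ofVec (sin α * cos β + cos α * sin β) (sin α * -sin β + cos α * cos β) = c := by
        rw [eq_ofVec_add_arcLength b c, ← hl, ← hβ, ← hα, sin_add, cos_add]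
        congr 1 <;> ring
      have pb : ofVec (cos α * sin β) (cos α * cos β) = b := by
        rw [ofVec_smul s2.ne', hβ, ofVec_sin_cos_angle]
      have pa : ofVec (cos α * sin β - sin α * cos β) (cos α * cos β - sin α * -sin β) = a := by
        rw [eq_ofVec_sub_arcLength a b, ← hβ, ← hα, sin_sub, cos_sub]
        congr 1 <;> ring
      rw [pe, pc, pb, pa] at key
      obtain ⟨k1, k2⟩ := key.chord
      constructor
      · refine chord_le_of_cross hM hd (e := f e) ?_ hdbe
        rw [chord_comm (f a) (f b), chord_comm (f c) (f e), chord_comm (f b) (f c),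
          chord_comm (f e) (f a)]
        linarith
      · rw [chord_comm (f b) (f c), chord_comm (f a) (f b)]
        refine chord_le_of_cross hM hd (e := f e) ?_ hdbe
        rw [chord_comm (f a) (f e), chord_comm (f e) (f c)] at *
        linarith
    · have h1 : a = e := by
        rw [eq_ofVec_sub_arcLength a b, eq_ofVec_sub_arcLength e b, heq, heb]
      have h2 : c = e := by
        rw [eq_ofVec_add_arcLength b c, eq_ofVec_add_arcLength b e, ← hl, heq, he]
      have hM1 : 1 ≤ M' := by
        rw [le_div_iff₀ hd]; linarith
      rw [h1, h2, chord_comm (f e) (f b), and_self]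
      exact le_mul_of_one_le_left (chord_nonneg _ _) hM1
  have D1 := two_mul_chord_le_arcLength (f a) (f b)
  have D2 := two_mul_chord_le_arcLength (f b) (f c)
  refine ratio_bounds (by positivity) (arcLength_pos fbc) ?_ ?_
  · rw [div_mul_eq_mul_div, div_mul_eq_mul_div, le_div_iff₀ hd]
    calc arcLength (f a) (f b) * d ≤ 2 * π * chord (f a) (f b) := by linarith
      _ ≤ 2 * π * (M' * chord (f b) (f c)) := by gcongr; exact C.1
      _ = π * M' * (2 * chord (f b) (f c)) := by ring
      _ ≤ _ := by gcongr
  · rw [div_mul_eq_mul_div, div_mul_eq_mul_div, le_div_iff₀ hd]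
    calc arcLength (f b) (f c) * d ≤ 2 * π * chord (f b) (f c) := by linarith
      _ ≤ 2 * π * (M' * chord (f a) (f b)) := by gcongr; exact C.2
      _ = π * M' * (2 * chord (f a) (f b)) := by ring
      _ ≤ _ := by gcongr

/-! ### Composition of quasisymmetric maps. -/

/-- The weak quasisymmetry inequalities with the constant `M`, without divisions. -/
def ArcBounded (M : ℝ) (h : Bdry → Bdry) : Prop :=
  ∀ a b c : Bdry, a ≠ b → arcLength a b = arcLength b c → arcLength a b ≤ π →
    arcLength (h a) (h b) ≤ M * arcLength (h b) (h c) ∧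
      arcLength (h b) (h c) ≤ M * arcLength (h a) (h b)

lemma Quasisymmetric.arcBounded {h : Bdry ≃ₜ Bdry} (hh : Quasisymmetric h) :
    ∃ M : ℝ, 0 < M ∧ ArcBounded M h := by
  obtain ⟨-, M, hM, H⟩ := hh
  refine ⟨M, hM, fun a b c hab hl hπ => ?_⟩
  have hbc : b ≠ c := ne_of_arcLength_pos (hl ▸ arcLength_pos hab)
  have hpos := arcLength_pos (h.injective.ne hbc)
  obtain ⟨h1, h2⟩ := H a b c hab hl hπ
  rw [div_le_div_iff₀ hM hpos] at h1
  rw [div_le_iff₀ hpos] at h2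
  exact ⟨h2, by linarith⟩

/-- Halve [a, b] at a': the image of the far half is at most M times that of the near half, so
passing to [a', b] costs a factor M + 1 and lowers the exponent by one. -/
lemma arcLength_le_two_pow {M : ℝ} (hM : 0 < M) {h : Bdry → Bdry} (hm : CyclicMono h)
    (hh : ArcBounded M h) (k : ℕ) : ∀ a b c : Bdry, a ≠ b → b ≠ c →
      arcLength a b + arcLength b c ≤ 2 * π → arcLength a b ≤ 2 ^ k * arcLength b c →
        arcLength (h a) (h b) ≤ (M + 1) ^ k * M * arcLength (h b) (h c) := by
  induction k with
  | zero =>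
    intro a b c hab hbc hsum hle
    rw [pow_zero, one_mul] at hle
    have h0 := arcLength_pos hab
    obtain ⟨c', hc'⟩ := exists_arcLength_right b h0.le (by linarith [arcLength_lt b c])
    have hbc' : b ≠ c' := ne_of_arcLength_pos (by linarith)
    have h1 := (hh a b c' hab hc'.symm (by linarith)).1
    have h2 : arcLength (h b) (h c') ≤ arcLength (h b) (h c) := by
      rcases hle.lt_or_eq with hlt | heq
      · have := (hm _ _ _ (posOrder_of_arcLength_lt hbc' (hc'.trans_lt hlt))).arcLength_add
        linarith [arcLength_nonneg (h c') (h c)]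
      · rw [show c' = c by
          rw [eq_ofVec_add_arcLength b c', eq_ofVec_add_arcLength b c, hc', heq]]
    rw [pow_zero, one_mul]
    exact h1.trans (by gcongr)
  | succ k ih =>
    intro a b c hab hbc hsum hle
    have h0 := arcLength_pos hab
    have h0' := arcLength_pos hbc
    obtain ⟨a', ha'⟩ := exists_arcLength_left b (t := arcLength a b / 2) (by linarith)
      (by linarith [arcLength_lt a b])
    have ha'b : a' ≠ b := ne_of_arcLength_pos (by linarith)
    have haa' : a ≠ a' := by rintro rfl; linarith
    have hpos : PosOrder a a' b := by
      by_contra hc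
      rcases posOrder_or_swap haa' ha'b hab.symm with h' | h'
      · exact hc h'
      · have := h'.rotate.rotate.arcLength_add
        linarith [arcLength_nonneg a' a]
    have hadd := hpos.arcLength_add
    have h1 := (hh a a' b haa' (by linarith) (by linarith)).1
    have h2 := (hm _ _ _ hpos).arcLength_add
    have h3 := ih a' b c ha'b hbc (by linarith) (by rw [pow_succ] at hle; linarith)
    calc arcLength (h a) (h b) ≤ (M + 1) * arcLength (h a') (h b) := by linarith
      _ ≤ (M + 1) * ((M + 1) ^ k * M * arcLength (h b) (h c)) := by gcongr
      _ = _ := by ring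

lemma arcLength_le_two_pow' {M : ℝ} (hM : 0 < M) {h : Bdry → Bdry} (hm : CyclicMono h)
    (hh : ArcBounded M h) (k : ℕ) : ∀ a b c : Bdry, a ≠ b → b ≠ c →
      arcLength a b + arcLength b c ≤ 2 * π → arcLength b c ≤ 2 ^ k * arcLength a b →
        arcLength (h b) (h c) ≤ (M + 1) ^ k * M * arcLength (h a) (h b) := by
  induction k with
  | zero =>
    intro a b c hab hbc hsum hle
    rw [pow_zero, one_mul] at hle
    have h0 := arcLength_pos hbc
    obtain ⟨a', ha'⟩ := exists_arcLength_left b h0.le (by linarith [arcLength_lt b c])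
    have ha'b : a' ≠ b := ne_of_arcLength_pos (by linarith)
    have h1 := (hh a' b c ha'b ha' (by linarith)).2
    have h2 : arcLength (h a') (h b) ≤ arcLength (h a) (h b) := by
      rcases hle.lt_or_eq with hlt | heq
      · have haa' : a ≠ a' := by rintro rfl; linarith
        have hpos : PosOrder a a' b := by
          by_contra hc
          rcases posOrder_or_swap haa' ha'b hab.symm with h' | h'
          · exact hc h'
          · have := h'.rotate.rotate.arcLength_add
            linarith [arcLength_nonneg a' a]
        have := (hm _ _ _ hpos).arcLength_add
        linarith [arcLength_nonneg (h a) (h a')]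
      · rw [show a' = a by
          rw [eq_ofVec_sub_arcLength a' b, eq_ofVec_sub_arcLength a b, ha', heq]]
    rw [pow_zero, one_mul]
    exact h1.trans (by gcongr)
  | succ k ih =>
    intro a b c hab hbc hsum hle
    have h0 := arcLength_pos hab
    have h0' := arcLength_pos hbc
    obtain ⟨c', hc'⟩ := exists_arcLength_right b (t := arcLength b c / 2) (by linarith)
      (by linarith [arcLength_lt b c])
    have hbc' : b ≠ c' := ne_of_arcLength_pos (by linarith)
    have hc'c : c' ≠ c := by rintro rfl; linarith
    have hpos : PosOrder b c' c := posOrder_of_arcLength_lt hbc' (by linarith)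
    have hadd := hpos.arcLength_add
    have h1 := (hh b c' c hbc' (by linarith) (by linarith)).2
    have h2 := (hm _ _ _ hpos).arcLength_add
    have h3 := ih a b c' hab hbc' (by linarith) (by rw [pow_succ] at hle; linarith)
    calc arcLength (h b) (h c) ≤ (M + 1) * arcLength (h b) (h c') := by linarith
      _ ≤ (M + 1) * ((M + 1) ^ k * M * arcLength (h a) (h b)) := by gcongr
      _ = _ := by ring

/-- `f` sends equal adjacent arcs to adjacent arcs of ratio at most L, and the halving lemmas bound
the distortion by `h` of arcs with ratio at most 2^k, where 2^k > L. -/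
theorem Quasisymmetric.trans {f h : Bdry ≃ₜ Bdry} (hf : Quasisymmetric f)
    (hh : Quasisymmetric h) : Quasisymmetric (f.trans h) := by
  obtain ⟨L, hL, hfL⟩ := hf.arcBounded
  obtain ⟨M, hM, hhM⟩ := hh.arcBounded
  have hfm : CyclicMono f := hf.1
  have hhm : CyclicMono h := hh.1
  obtain ⟨k, hk⟩ := pow_unbounded_of_one_lt L (one_lt_two (α := ℝ))
  refine ⟨fun a b c habc => hhm _ _ _ (hfm _ _ _ habc), (M + 1) ^ k * M, by positivity, ?_⟩
  intro a b c hab hl hπ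
  have h0 := arcLength_pos hab
  have hbc : b ≠ c := ne_of_arcLength_pos (hl ▸ h0)
  obtain ⟨h1, h2⟩ := hfL a b c hab hl hπ
  have fab := f.injective.ne hab
  have fbc := f.injective.ne hbc
  have hsum : arcLength (f a) (f b) + arcLength (f b) (f c) ≤ 2 * π := by
    rcases hπ.lt_or_eq with hlt | heq
    · have := (hfm _ _ _ (posOrder_of_arcLength hab hbc (by linarith))).arcLength_add
      linarith [arcLength_lt (f a) (f c)]
    · have hba := arcLength_add_swap hab
      have : c = a := by
        rw [eq_ofVec_add_arcLength b c, eq_ofVec_add_arcLength b a, ← hl,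
          show arcLength b a = arcLength a b by linarith]
      rw [this, arcLength_add_swap fab]
  have hpos1 := arcLength_nonneg (f a) (f b)
  have hpos2 := arcLength_nonneg (f b) (f c)
  exact ratio_bounds (by positivity) (arcLength_pos (h.injective.ne fbc))
    (arcLength_le_two_pow hM hhm hhM k (f a) (f b) (f c) fab fbc hsum
      (h1.trans (mul_le_mul_of_nonneg_right hk.le hpos2)))
    (arcLength_le_two_pow' hM hhm hhM k (f a) (f b) (f c) fab fbc hsum
      (h2.trans (mul_le_mul_of_nonneg_right hk.le hpos1)))

/-! ### Ptolemy's identity and the combinatorics of flips of the Farey triangulation. -/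

lemma PosOrder.trans {a b c d : Bdry} (h1 : PosOrder a b c) (h2 : PosOrder a c d) :
    PosOrder a b d := by
  unfold PosOrder at *; grind

lemma PosOrder.trans' {a b c d : Bdry} (h1 : PosOrder a b c) (h2 : PosOrder a c d) :
    PosOrder b c d := by
  unfold PosOrder at *; grind

/-- Ptolemy's identity. -/
lemma intDet_ptolemy {a b c d : Bdry} (h1 : PosOrder a b c) (h2 : PosOrder a c d) :
    intDet a c * intDet b d = intDet a b * intDet c d + intDet a d * intDet b c := by
  have key : |wedge a c| * |wedge b d| =
      |wedge a b| * |wedge c d| + |wedge a d| * |wedge b c| := by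
    rw [posOrder_iff_wedge] at h1 h2
    rw [← abs_mul, wedge_plucker, ← abs_mul, ← abs_mul]
    have hpos : 0 < (wedge a b * wedge c d) * (wedge a d * wedge b c) := by
      have h3 := mul_pos h1 h2
      rw [wedge_swap a c, wedge_swap a d] at h3
      have h4 : 0 < wedge a c ^ 2 := by
        have : wedge a c ≠ 0 := by rintro h; simp [h] at h3
        positivity
      refine (mul_pos_iff_of_pos_left h4).1 (h3.trans_eq ?_)
      ring
    rcases pos_and_pos_or_neg_and_neg_of_mul_pos hpos with ⟨h, h'⟩ | ⟨h, h'⟩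
    · rw [abs_of_pos h, abs_of_pos h', abs_of_pos (add_pos h h')]
    · rw [abs_of_neg h, abs_of_neg h', abs_of_neg (add_neg h h')]; ring
  simp only [intDet]
  linear_combination (den a : ℝ) * den b * den c * den d * key

lemma intDet_farey_cross {a b c d : Bdry} (h1 : PosOrder a b c) (h2 : PosOrder a c d)
    (hac : intDet a c ≠ 0) (hbd : intDet b d ≠ 0) :
    1 ≤ intDet a b ∧ 1 ≤ intDet b c ∧ 1 ≤ intDet c d ∧ 1 ≤ intDet a d :=
  ⟨one_le_intDet (den_left_ne_zero hac) (den_left_ne_zero hbd) h1.ne,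
    one_le_intDet (den_left_ne_zero hbd) (den_right_ne_zero hac) h1.rotate.ne,
    one_le_intDet (den_right_ne_zero hac) (den_right_ne_zero hbd) h2.rotate.ne,
    one_le_intDet (den_left_ne_zero hac) (den_right_ne_zero hbd) h2.rotate.rotate.ne.symm⟩

lemma isTriangle_farey {a b c : Bdry} : IsTriangle farey a b c ↔
    intDet a b = 1 ∧ intDet b c = 1 ∧ intDet a c = 1 := by
  simp only [IsTriangle, mem_farey]

lemma farey_not_cross {a b c d : Bdry} (h1 : PosOrder a b c) (h2 : PosOrder a c d)
    (hac : intDet a c = 1) : intDet b d ≠ 1 := by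
  intro hbd
  obtain ⟨k1, k2, k3, k4⟩ := intDet_farey_cross h1 h2 (by rw [hac]; exact one_ne_zero)
    (by rw [hbd]; exact one_ne_zero)
  have := intDet_ptolemy h1 h2
  rw [hac, hbd] at this
  nlinarith

lemma IsQuad.swap {T : Set (Sym2 Bdry)} {a b c d : Bdry} (h : IsQuad T a b c d) :
    IsQuad T c d a b := by
  obtain ⟨h1, h2, ⟨t1, t2, t3⟩, ⟨t4, t5, t6⟩⟩ := h
  refine ⟨h2.rotate, h1.rotate.rotate, ⟨t5, ?_, ?_⟩, ⟨?_, t1, ?_⟩⟩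
  · rwa [Sym2.eq_swap]
  · rwa [Sym2.eq_swap]
  · rwa [Sym2.eq_swap]
  · rwa [Sym2.eq_swap]

lemma IsQuad.intDet_diagonal {a b c d : Bdry} (h : IsQuad farey a b c d) : intDet b d = 2 := by
  obtain ⟨h1, h2, t1, t2⟩ := h
  rw [isTriangle_farey] at t1 t2
  have := intDet_ptolemy h1 h2
  rw [t1.1, t1.2.1, t1.2.2, t2.2.1, t2.2.2] at this
  linarith

lemma mem_flip {T S : Set (Sym2 Bdry)} {x y : Bdry} : s(x, y) ∈ flip T S ↔
    (s(x, y) ∈ T ∧ s(x, y) ∉ S) ∨ ∃ a c, s(a, c) ∈ S ∧ IsQuad T a x c y := by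
  constructor
  · rintro (h | ⟨a, b, c, d, hS, hq, he⟩)
    · exact Or.inl h
    · right
      rcases Sym2.eq_iff.1 he with ⟨rfl, rfl⟩ | ⟨rfl, rfl⟩
      · exact ⟨a, c, hS, hq⟩
      · exact ⟨c, a, by rwa [Sym2.eq_swap], hq.swap⟩
  · rintro (h | ⟨a, c, hS, hq⟩)
    · exact Or.inl h
    · exact Or.inr ⟨a, x, c, y, hS, hq, rfl⟩

section
variable {S : Set (Sym2 Bdry)} {x y : Bdry}

lemma intDet_of_mem_flip (h : s(x, y) ∈ flip farey S) : intDet x y = 1 ∨ intDet x y = 2 := by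
  rcases mem_flip.1 h with h | ⟨a, c, -, hq⟩
  · exact Or.inl (mem_farey.1 h.1)
  · exact Or.inr hq.intDet_diagonal

/-- Two distinct such points would violate Ptolemy's identity, which would read 1 = 1 + 2 · `intDet
c c'` for a suitable labelling. -/
lemma eq_of_intDet_eq_one {b c c' d : Bdry} (h : PosOrder b c d) (h' : PosOrder b c' d)
    (hbd : intDet b d = 2) (h1 : intDet b c = 1) (h2 : intDet c d = 1) (h3 : intDet b c' = 1)
    (h4 : intDet c' d = 1) : c = c' := by
  have key : ∀ c c' : Bdry, PosOrder b c c' → PosOrder b c' d → intDet b c = 1 →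
      intDet c d = 1 → intDet b c' = 1 → intDet c' d = 1 → False := by
    intro c c' p1 p2 h1 h2 h3 h4
    have := intDet_ptolemy p1 p2
    have hc : 1 ≤ intDet c c' := one_le_intDet
      (den_right_ne_zero (by rw [h1]; exact one_ne_zero))
      (den_right_ne_zero (by rw [h3]; exact one_ne_zero)) p1.rotate.ne
    rw [h1, h2, h3, h4, hbd] at this
    linarith
  by_contra hne
  rcases posOrder_or_swap h.ne hne h'.ne.symm with p | p
  · exact key c c' p h' h1 h2 h3 h4
  · exact key c' c p h h3 h4 h1 h2

/-- If a new diagonal bd crosses the Farey edge ac, Ptolemy's identity reads 2 = ab · cd + ad · bc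
and forces all four sides to have determinant 1. By uniqueness of the common neighbours on each side
of bd, ac is the edge that bd replaced, so it was flipped. -/
lemma unflipped_not_cross {a b c d : Bdry} (h1 : PosOrder a b c) (h2 : PosOrder a c d)
    (hac : intDet a c = 1) (hS : s(a, c) ∉ S) : s(b, d) ∉ flip farey S := by
  intro h
  rcases mem_flip.1 h with h | ⟨a', c', hS', hq⟩
  · exact farey_not_cross h1 h2 hac (mem_farey.1 h.1)
  · have hbd := hq.intDet_diagonal
    obtain ⟨k1, k2, k3, k4⟩ := intDet_farey_cross h1 h2 (by rw [hac]; exact one_ne_zero)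
      (by rw [hbd]; exact two_ne_zero)
    have hp := intDet_ptolemy h1 h2
    rw [hac, hbd] at hp
    have e1 : intDet a b = 1 := by nlinarith
    have e2 : intDet b c = 1 := by nlinarith
    have e3 : intDet c d = 1 := by nlinarith
    have e4 : intDet a d = 1 := by nlinarith
    obtain ⟨q1, q2, t1, t2⟩ := hq
    rw [isTriangle_farey] at t1 t2
    have hc : c = c' := eq_of_intDet_eq_one (h1.trans' h2) (q1.trans' q2) hbd e2 e3 t1.2.1 t2.2.1
    have ha : a = a' := eq_of_intDet_eq_one (h1.trans h2).rotate.rotate (q1.trans q2).rotate.rotate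
      (by rwa [intDet_comm]) (by rwa [intDet_comm]) e1 (by rw [intDet_comm]; exact t2.2.2) t1.1
    subst hc ha
    exact hS hS'

lemma IsFlip.left_notMem {T : Set (Sym2 Bdry)} (hS : IsFlip T S) {a b c : Bdry}
    (h : IsTriangle T a b c) (hm : s(b, c) ∈ S) : s(a, b) ∉ S :=
  fun h' => hS.disjoint a b c h ⟨h', hm⟩

/-- For a kept edge, take the third vertex of the Farey triangle on that side, or, if one of its
other sides is flipped, the opposite vertex beyond that side. For a new diagonal, take an endpoint
of the edge it replaced. The sides used are kept because a triangle has at most one flipped side. -/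
lemma exists_flip_third (hS : IsFlip farey S) (h : s(x, y) ∈ flip farey S) :
    ∃ z, PosOrder x z y ∧ s(x, z) ∈ flip farey S ∧ s(z, y) ∈ flip farey S := by
  rcases mem_flip.1 h with h | ⟨a, c, hac, hq⟩
  · obtain ⟨hxy, -⟩ := h
    rw [mem_farey] at hxy
    obtain ⟨z, hz, hxz, hzy⟩ := exists_farey_third hxy
    by_cases h1 : s(x, z) ∈ S
    · obtain ⟨e, he, hxe, hez⟩ := exists_farey_third hxz
      refine ⟨e, he.trans hz, ?_, ?_⟩
      · refine mem_flip.2 (Or.inl ⟨mem_farey.2 hxe, ?_⟩)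
        rw [Sym2.eq_swap]
        exact hS.left_notMem (isTriangle_farey.2 ⟨by rwa [intDet_comm], hxz, hez⟩) h1
      · exact mem_flip.2 (Or.inr ⟨x, z, h1, he, hz, isTriangle_farey.2 ⟨hxe, hez, hxz⟩,
          isTriangle_farey.2 ⟨hxz, hzy, hxy⟩⟩)
    by_cases h2 : s(z, y) ∈ S
    · obtain ⟨e, he, hze, hey⟩ := exists_farey_third hzy
      refine ⟨e, (he.trans' hz.rotate).rotate.rotate, ?_, ?_⟩
      · rw [Sym2.eq_swap]
        refine mem_flip.2 (Or.inr ⟨z, y, h2, he, hz.rotate, isTriangle_farey.2 ⟨hze, hey, hzy⟩,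
          isTriangle_farey.2 ⟨hzy, ?_, ?_⟩⟩)
        · rwa [intDet_comm]
        · rwa [intDet_comm]
      · refine mem_flip.2 (Or.inl ⟨mem_farey.2 hey, ?_⟩)
        refine hS.left_notMem (c := z) (isTriangle_farey.2 ⟨hey, ?_, ?_⟩) ?_
        · rwa [intDet_comm]
        · rwa [intDet_comm]
        · rwa [Sym2.eq_swap]
    · exact ⟨z, hz, mem_flip.2 (Or.inl ⟨mem_farey.2 hxz, h1⟩),
        mem_flip.2 (Or.inl ⟨mem_farey.2 hzy, h2⟩)⟩
  · obtain ⟨q1, q2, t1, t2⟩ := hq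
    rw [isTriangle_farey] at t1 t2
    refine ⟨c, q1.trans' q2, mem_flip.2 (Or.inl ⟨mem_farey.2 t1.2.1, ?_⟩),
      mem_flip.2 (Or.inl ⟨mem_farey.2 t2.2.1, ?_⟩)⟩
    · refine hS.left_notMem (c := a) (isTriangle_farey.2 ⟨t1.2.1, ?_, ?_⟩) ?_
      · rw [intDet_comm]; exact t1.2.2
      · rw [intDet_comm]; exact t1.1
      · rwa [Sym2.eq_swap]
    · rw [Sym2.eq_swap]
      refine hS.left_notMem (c := a) (isTriangle_farey.2 ⟨?_, ?_, ?_⟩) ?_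
      · rw [intDet_comm]; exact t2.2.1
      · rw [intDet_comm]; exact t2.1
      · rw [intDet_comm]; exact t2.2.2
      · rwa [Sym2.eq_swap]

/-- In the triangle 0, 1, ∞ at most one of the two sides at infinity is flipped. -/
lemma exists_flip_edge_infty (hS : IsFlip farey S) :
    ∃ t : ℝ, s((t : Bdry), OnePoint.infty) ∈ flip farey S := by
  have h0 : ∀ n : ℤ, intDet ((n : ℝ) : Bdry) OnePoint.infty = 1 := fun n => by
    rw [intDet_coe_infty, den_intCast]; simp
  have h01 : intDet (((0 : ℤ) : ℝ) : Bdry) (((1 : ℤ) : ℝ) : Bdry) = 1 := by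
    rw [intDet_coe_coe, den_intCast, den_intCast]; simp
  by_cases h : s((((0 : ℤ) : ℝ) : Bdry), OnePoint.infty) ∈ S
  · refine ⟨((1 : ℤ) : ℝ), mem_flip.2 (Or.inl ⟨mem_farey.2 (h0 1), ?_⟩)⟩
    refine hS.left_notMem (c := ((0 : ℤ) : ℝ)) (isTriangle_farey.2 ⟨h0 1, ?_, ?_⟩) ?_
    · rw [intDet_comm]; exact h0 0
    · rw [intDet_comm]; exact h01
    · rwa [Sym2.eq_swap]
  · exact ⟨((0 : ℤ) : ℝ), mem_flip.2 (Or.inl ⟨mem_farey.2 (h0 0), h⟩)⟩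

end

/-- The empty flip lets the Farey triangulation itself be treated by the lemmas on flipped
triangulations. -/
lemma isFlip_empty (T : Set (Sym2 Bdry)) : IsFlip T ∅ :=
  ⟨Set.empty_subset _, fun _ h => absurd h (Set.notMem_empty _), fun _ _ _ _ h => h.1⟩

lemma flip_empty (T : Set (Sym2 Bdry)) : flip T ∅ = T := by
  ext e
  simp [flip]

/-! ### Transport of triangulations and flips by a homeomorphism. -/

lemma mem_mapTri {h : Bdry ≃ₜ Bdry} {T : Set (Sym2 Bdry)} {a b : Bdry} :
    s(a, b) ∈ mapTri h T ↔ s(h.symm a, h.symm b) ∈ T := by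
  constructor
  · rintro ⟨e, he, heq⟩
    induction e using Sym2.ind with
    | _ x y =>
      rw [Sym2.map_mk, Sym2.eq_iff] at heq
      rcases heq with ⟨rfl, rfl⟩ | ⟨rfl, rfl⟩
      · simpa using he
      · rw [Sym2.eq_swap]; simpa using he
  · intro hm
    exact ⟨_, hm, by simp⟩

lemma isTriangle_mapTri {h : Bdry ≃ₜ Bdry} {T : Set (Sym2 Bdry)} {a b c : Bdry} :
    IsTriangle (mapTri h T) a b c ↔ IsTriangle T (h.symm a) (h.symm b) (h.symm c) := by
  simp only [IsTriangle, mem_mapTri]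

lemma isQuad_mapTri {h : Bdry ≃ₜ Bdry} (hh : CyclicMono h) {T : Set (Sym2 Bdry)}
    {a b c d : Bdry} : IsQuad (mapTri h T) a b c d ↔
      IsQuad T (h.symm a) (h.symm b) (h.symm c) (h.symm d) := by
  simp only [IsQuad, isTriangle_mapTri, hh.symm.posOrder_iff]

lemma mapTri_mapTri_symm (h : Bdry ≃ₜ Bdry) (S : Set (Sym2 Bdry)) :
    mapTri h (mapTri h.symm S) = S := by
  ext e
  induction e using Sym2.ind with
  | _ x y => simp [mem_mapTri]

lemma flip_mapTri {h : Bdry ≃ₜ Bdry} (hh : CyclicMono h) (T S : Set (Sym2 Bdry)) :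
    flip (mapTri h T) (mapTri h S) = mapTri h (flip T S) := by
  ext e
  induction e using Sym2.ind with
  | _ x y =>
    simp only [mem_flip, mem_mapTri, isQuad_mapTri hh]
    constructor
    · rintro (h1 | ⟨a, c, h1, h2⟩)
      · exact Or.inl h1
      · exact Or.inr ⟨_, _, h1, h2⟩
    · rintro (h1 | ⟨a, c, h1, h2⟩)
      · exact Or.inl h1
      · exact Or.inr ⟨h a, h c, by simpa using h1, by simpa using h2⟩

lemma IsFlip.of_mapTri {h : Bdry ≃ₜ Bdry} (hh : CyclicMono h) {T S : Set (Sym2 Bdry)}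
    (hS : IsFlip (mapTri h T) (mapTri h S)) : IsFlip T S where
  subset := by
    intro e
    induction e using Sym2.ind with
    | _ x y =>
      intro he
      have : s(h x, h y) ∈ mapTri h S := mem_mapTri.2 (by simpa using he)
      simpa [mem_mapTri] using hS.subset this
  diagonal := by
    intro e
    induction e using Sym2.ind with
    | _ x y =>
      intro he
      have : s(h x, h y) ∈ mapTri h S := mem_mapTri.2 (by simpa using he)
      obtain ⟨a, b, c, d, hq, heq⟩ := hS.diagonal _ this
      refine ⟨_, _, _, _, (isQuad_mapTri hh).1 hq, ?_⟩
      have := congrArg (Sym2.map h.symm) heq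
      simpa using this
  disjoint := by
    intro a b c ht hm
    refine hS.disjoint (h a) (h b) (h c) (isTriangle_mapTri.2 (by simpa using ht)) ?_
    simpa [mem_mapTri] using hm

/-! ### Binary subdivision trees in linear orders. -/

section Tree
variable {V V' : Type*} [LinearOrder V] [LinearOrder V']

/-- The subdivision point of the interval reached from `(a, b)` by descending left (`false`) or
right (`true`), where `mid` subdivides each interval into two. -/
def treePoint (mid : V → V → V) : V → V → List Bool → V
  | a, b, [] => mid a b
  | a, b, false :: w => treePoint mid a (mid a b) w
  | a, b, true :: w => treePoint mid (mid a b) b w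

/-- `mid` subdivides every interval satisfying `G` into two intervals satisfying `G`. -/
def Subdivides (mid : V → V → V) (G : V → V → Prop) : Prop :=
  ∀ a b, G a b → a < mid a b ∧ mid a b < b ∧ G a (mid a b) ∧ G (mid a b) b

/-- `(x, y)` is obtained from `(a, b)` by successive subdivision. -/
inductive Descends (mid : V → V → V) : V → V → V → V → Prop
  | refl (a b : V) : Descends mid a b a b
  | left {a b x y : V} : Descends mid a (mid a b) x y → Descends mid a b x y
  | right {a b x y : V} : Descends mid (mid a b) b x y → Descends mid a b x y

variable {mid : V → V → V} {G : V → V → Prop} {mid' : V' → V' → V'} {G' : V' → V' → Prop}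

lemma treePoint_mem (h : Subdivides mid G) (w : List Bool) :
    ∀ a b, G a b → a < treePoint mid a b w ∧ treePoint mid a b w < b := by
  induction w with
  | nil => exact fun a b hab => ⟨(h a b hab).1, (h a b hab).2.1⟩
  | cons d w ih =>
    intro a b hab
    obtain ⟨h1, h2, h3, h4⟩ := h a b hab
    cases d with
    | false => exact ⟨(ih _ _ h3).1, (ih _ _ h3).2.trans h2⟩
    | true => exact ⟨h1.trans (ih _ _ h4).1, (ih _ _ h4).2⟩

/-- The order of two nodes depends only on their addresses, so it is the same in every tree. -/
lemma treePoint_lt (h : Subdivides mid G) (h' : Subdivides mid' G') (w : List Bool) :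
    ∀ v a b a' b', G a b → G' a' b' → treePoint mid a b w < treePoint mid a b v →
      treePoint mid' a' b' w < treePoint mid' a' b' v := by
  induction w with
  | nil =>
    intro v a b a' b' hab hab' hlt
    obtain ⟨-, -, h3, h4⟩ := h a b hab
    obtain ⟨-, -, h3', h4'⟩ := h' a' b' hab'
    cases v with
    | nil => exact absurd hlt (lt_irrefl _)
    | cons d v =>
      cases d with
      | false => exact absurd hlt (treePoint_mem h v _ _ h3).2.le.not_gt
      | true => exact (treePoint_mem h' v _ _ h4').1
  | cons e w ih =>
    intro v a b a' b' hab hab' hlt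
    obtain ⟨-, -, h3, h4⟩ := h a b hab
    obtain ⟨-, -, h3', h4'⟩ := h' a' b' hab'
    cases v with
    | nil =>
      cases e with
      | false => exact (treePoint_mem h' w _ _ h3').2
      | true => exact absurd hlt (treePoint_mem h w _ _ h4).1.le.not_gt
    | cons d v =>
      cases e <;> cases d
      · exact ih v _ _ _ _ h3 h3' hlt
      · exact (treePoint_mem h' w _ _ h3').2.trans (treePoint_mem h' v _ _ h4').1
      · exact absurd hlt
          ((treePoint_mem h v _ _ h3).2.trans (treePoint_mem h w _ _ h4).1).le.not_gt
      · exact ih v _ _ _ _ h4 h4' hlt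

lemma Descends.good (h : Subdivides mid G) {a b x y : V} (hd : Descends mid a b x y)
    (hab : G a b) : G x y ∧ a ≤ x ∧ y ≤ b := by
  induction hd with
  | refl a b => exact ⟨hab, le_rfl, le_rfl⟩
  | left hd ih =>
    obtain ⟨-, h2, h3, -⟩ := h _ _ hab
    obtain ⟨i1, i2, i3⟩ := ih h3
    exact ⟨i1, i2, i3.trans h2.le⟩
  | right hd ih =>
    obtain ⟨h1, -, -, h4⟩ := h _ _ hab
    obtain ⟨i1, i2, i3⟩ := ih h4
    exact ⟨i1, h1.le.trans i2, i3⟩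

/-- A pair of vertices of the tree is either one of its intervals or crosses one of them. -/
lemma descends_or_cross (h : Subdivides mid G) (n : ℕ) : ∀ a b x y, G a b → x < y →
    (x = a ∨ x = b ∨ ∃ w : List Bool, w.length < n ∧ x = treePoint mid a b w) →
    (y = a ∨ y = b ∨ ∃ w : List Bool, w.length < n ∧ y = treePoint mid a b w) →
    Descends mid a b x y ∨ ∃ p q, Descends mid a b p q ∧
      ((x < p ∧ p < y ∧ y < q) ∨ (p < x ∧ x < q ∧ q < y)) := by
  induction n with
  | zero =>
    intro a b x y hab hxy hx hy
    obtain ⟨h1, h2, -⟩ := h a b hab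
    have hlt := h1.trans h2
    simp only [Nat.not_lt_zero, false_and, exists_false, or_false] at hx hy
    rcases hx with rfl | rfl <;> rcases hy with rfl | rfl
    · exact absurd hxy (lt_irrefl _)
    · exact Or.inl (.refl _ _)
    · exact absurd hxy hlt.le.not_gt
    · exact absurd hxy (lt_irrefl _)
  | succ n ih =>
    intro a b x y hab hxy hx hy
    obtain ⟨h1, h2, h3, h4⟩ := h a b hab
    have low : ∀ z, z ≤ mid a b →
        (z = a ∨ z = b ∨ ∃ w : List Bool, w.length < n + 1 ∧ z = treePoint mid a b w) →
        (z = a ∨ z = mid a b ∨ ∃ w : List Bool, w.length < n ∧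
          z = treePoint mid a (mid a b) w) := by
      rintro z hz (rfl | rfl | ⟨w, hw, rfl⟩)
      · exact Or.inl rfl
      · exact absurd hz h2.not_ge
      · match w with
        | [] => exact Or.inr (Or.inl rfl)
        | false :: w => exact Or.inr (Or.inr ⟨w, by simpa using hw, rfl⟩)
        | true :: w => exact absurd hz (treePoint_mem h w _ _ h4).1.not_ge
    have high : ∀ z, mid a b ≤ z →
        (z = a ∨ z = b ∨ ∃ w : List Bool, w.length < n + 1 ∧ z = treePoint mid a b w) →
        (z = mid a b ∨ z = b ∨ ∃ w : List Bool, w.length < n ∧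
          z = treePoint mid (mid a b) b w) := by
      rintro z hz (rfl | rfl | ⟨w, hw, rfl⟩)
      · exact absurd hz h1.not_ge
      · exact Or.inr (Or.inl rfl)
      · match w with
        | [] => exact Or.inl rfl
        | false :: w => exact absurd hz (treePoint_mem h w _ _ h3).2.not_ge
        | true :: w => exact Or.inr (Or.inr ⟨w, by simpa using hw, rfl⟩)
    rcases le_or_gt y (mid a b) with hy' | hy'
    · rcases ih a (mid a b) x y h3 hxy (low x (hxy.le.trans hy') hx) (low y hy' hy) with
        hd | ⟨p, q, hd, hc⟩
      · exact Or.inl hd.left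
      · exact Or.inr ⟨p, q, hd.left, hc⟩
    rcases le_or_gt (mid a b) x with hx' | hx'
    · rcases ih (mid a b) b x y h4 hxy (high x hx' hx) (high y (hx'.trans hxy.le) hy) with
        hd | ⟨p, q, hd, hc⟩
      · exact Or.inl hd.right
      · exact Or.inr ⟨p, q, hd.right, hc⟩
    have hax : a ≤ x := by
      rcases hx with rfl | rfl | ⟨w, -, rfl⟩
      · exact le_rfl
      · exact (h1.trans h2).le
      · exact (treePoint_mem h w _ _ hab).1.le
    have hyb : y ≤ b := by
      rcases hy with rfl | rfl | ⟨w, -, rfl⟩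
      · exact (h1.trans h2).le
      · exact le_rfl
      · exact (treePoint_mem h w _ _ hab).2.le
    rcases hax.eq_or_lt with rfl | hax
    -- Now x < mid a b < y. Unless the pair is (a, b) itself, it crosses one of the two halves.
    · rcases hyb.eq_or_lt with rfl | hyb
      · exact Or.inl (.refl _ _)
      · exact Or.inr ⟨_, _, .right (.refl _ _), Or.inl ⟨h1, hy', hyb⟩⟩
    · exact Or.inr ⟨_, _, .left (.refl _ _), Or.inr ⟨hax, hx', hy'⟩⟩

end Tree

lemma Descends.map_good {V V' : Type*} [LinearOrder V'] {mid : V → V → V}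
    {mid' : V' → V' → V'} {G' : V' → V' → Prop} (h' : Subdivides mid' G') {e : V → V'} {a b x y : V}
    (hd : Descends mid a b x y) (hab : G' (e a) (e b))
    (he : ∀ w, e (treePoint mid a b w) = treePoint mid' (e a) (e b) w) : G' (e x) (e y) := by
  induction hd with
  | refl a b => exact hab
  | @left a b x y hd ih =>
    obtain ⟨-, -, h3, -⟩ := h' _ _ hab
    have hm : e (mid a b) = mid' (e a) (e b) := he []
    rw [← hm] at h3
    refine ih h3 fun w => ?_
    rw [hm]
    exact he (false :: w)
  | @right a b x y hd ih =>
    obtain ⟨-, -, -, h4⟩ := h' _ _ hab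
    have hm : e (mid a b) = mid' (e a) (e b) := he []
    rw [← hm] at h4
    refine ih h4 fun w => ?_
    rw [hm]
    exact he (true :: w)

/-! ### Extension from the rationals to the reals. -/

/-- A strictly increasing surjection of the rationals extends to the reals. -/
lemma exists_orderIso_extending {φ : ℚ → ℚ} (hφ : StrictMono φ) (hs : Function.Surjective φ) :
    ∃ g : ℝ ≃o ℝ, ∀ q : ℚ, g q = φ q := by
  let A : ℝ → Set ℝ := fun x => {y | ∃ q : ℚ, (q : ℝ) < x ∧ y = φ q}
  have hne : ∀ x, (A x).Nonempty := fun x => by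
    obtain ⟨q, hq⟩ := exists_rat_lt x
    exact ⟨_, q, hq, rfl⟩
  have hle : ∀ (x : ℝ) (r : ℚ), x ≤ r → ∀ y ∈ A x, y ≤ φ r := by
    rintro x r hxr y ⟨q, hq, rfl⟩
    exact_mod_cast (hφ (by exact_mod_cast hq.trans_le hxr)).le
  have hbdd : ∀ x, BddAbove (A x) := fun x => by
    obtain ⟨r, hr⟩ := exists_rat_gt x
    exact ⟨φ r, hle x r hr.le⟩
  let g : ℝ → ℝ := fun x => sSup (A x)
  have hg1 : ∀ (x : ℝ) (r : ℚ), x ≤ r → g x ≤ φ r := fun x r hxr =>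
    csSup_le (hne x) (hle x r hxr)
  have hg2 : ∀ (x : ℝ) (r : ℚ), (r : ℝ) < x → (φ r : ℝ) ≤ g x := fun x r hr =>
    le_csSup (hbdd x) ⟨r, hr, rfl⟩
  have hmono : StrictMono g := by
    intro x y hxy
    obtain ⟨q, h1, h2⟩ := exists_rat_btwn hxy
    obtain ⟨r, h3, h4⟩ := exists_rat_btwn h2
    have : (φ q : ℝ) < φ r := by exact_mod_cast hφ (by exact_mod_cast h3)
    exact (hg1 x q h1.le).trans_lt (this.trans_le (hg2 y r h4))
  have hval : ∀ q : ℚ, g q = φ q := by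
    intro q
    refine le_antisymm (hg1 _ _ le_rfl) ?_
    -- A jump of `g` at `q` would contain a rational, which is a value of φ by surjectivity.
    by_contra! hlt
    obtain ⟨s, h1, h2⟩ := exists_rat_btwn hlt
    obtain ⟨r, rfl⟩ := hs s
    have hrq : r < q := hφ.lt_iff_lt.1 (by exact_mod_cast h2)
    exact absurd (hg2 q r (by exact_mod_cast hrq)) h1.not_ge
  have hsurj : Function.Surjective g := by
    intro y
    let B : Set ℝ := {x | ∃ q : ℚ, x = q ∧ (φ q : ℝ) < y}
    have hB : B.Nonempty := by
      obtain ⟨s, h⟩ := exists_rat_lt y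
      obtain ⟨r, rfl⟩ := hs s
      exact ⟨_, r, rfl, h⟩
    have hB' : BddAbove B := by
      obtain ⟨s, h⟩ := exists_rat_gt y
      obtain ⟨r, rfl⟩ := hs s
      refine ⟨r, ?_⟩
      rintro _ ⟨q, rfl, hq⟩
      exact_mod_cast (hφ.lt_iff_lt.1 (by exact_mod_cast hq.trans h)).le
    refine ⟨sSup B, ?_⟩
    rcases lt_trichotomy (g (sSup B)) y with hlt | heq | hlt
    · exfalso
      obtain ⟨s, h1, h2⟩ := exists_rat_btwn hlt
      obtain ⟨r, rfl⟩ := hs s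
      have hr : (r : ℝ) ≤ sSup B := le_csSup hB' ⟨r, rfl, h2⟩
      have := hmono.monotone hr
      rw [hval] at this
      exact absurd h1 this.not_gt
    · exact heq
    · exfalso
      obtain ⟨s, h1, h2⟩ := exists_rat_btwn hlt
      obtain ⟨r, rfl⟩ := hs s
      rw [← hval r] at h2
      obtain ⟨_, ⟨q, rfl, hq⟩, hrq⟩ := exists_lt_of_lt_csSup hB (hmono.lt_iff_lt.1 h2)
      have : φ q < φ r := by exact_mod_cast hq.trans h1
      exact absurd (hφ.lt_iff_lt.1 this) (not_lt.2 (by exact_mod_cast hrq.le))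
  exact ⟨hmono.orderIsoOfSurjective g hsurj, hval⟩

/-! ### Triangulations as subdivision trees of the extended real line. -/

/-- The boundary point of an extended real number; both infinities go to the point at infinity. -/
noncomputable def toBdry (x : EReal) : Bdry :=
  if x = ⊥ ∨ x = ⊤ then OnePoint.infty else (x.toReal : Bdry)

@[simp] lemma toBdry_bot : toBdry ⊥ = OnePoint.infty := by simp [toBdry]
@[simp] lemma toBdry_top : toBdry ⊤ = OnePoint.infty := by simp [toBdry]
@[simp] lemma toBdry_coe (x : ℝ) : toBdry (x : EReal) = (x : Bdry) := by simp [toBdry]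

lemma posOrder_toBdry {a c b : EReal} (h1 : a < c) (h2 : c < b) (hab : ¬ (a = ⊥ ∧ b = ⊤)) :
    PosOrder (toBdry a) (toBdry c) (toBdry b) := by
  induction c using EReal.rec with
  | bot => exact absurd h1 not_lt_bot
  | top => exact absurd h2 not_top_lt
  | coe c =>
    induction a using EReal.rec with
    | top => exact absurd h1 not_top_lt
    | bot =>
      induction b using EReal.rec with
      | top => exact absurd ⟨rfl, rfl⟩ hab
      | bot => exact absurd h2 not_lt_bot
      | coe b =>
        simp only [toBdry_bot, toBdry_coe]
        exact (posOrder_coe_coe_infty.2 (EReal.coe_lt_coe_iff.1 h2)).rotate.rotate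
    | coe a =>
      induction b using EReal.rec with
      | top =>
        simp only [toBdry_top, toBdry_coe]
        exact posOrder_coe_coe_infty.2 (EReal.coe_lt_coe_iff.1 h1)
      | bot => exact absurd h2 not_lt_bot
      | coe b =>
        simp only [toBdry_coe]
        exact posOrder_coe_of_lt (EReal.coe_lt_coe_iff.1 h1) (EReal.coe_lt_coe_iff.1 h2)

lemma exists_real_of_posOrder {a b : EReal} (hab : a < b) {z : Bdry}
    (h : PosOrder (toBdry a) z (toBdry b)) : ∃ c : ℝ, z = (c : Bdry) ∧ a < c ∧ c < b := by
  induction z using OnePoint.rec with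
  | infty =>
    exfalso
    induction a using EReal.rec with
    | bot => rw [toBdry_bot] at h; exact h.ne rfl
    | top => exact absurd hab not_top_lt
    | coe a =>
      induction b using EReal.rec with
      | bot => exact absurd hab not_lt_bot
      | top => rw [toBdry_top] at h; exact h.rotate.ne rfl
      | coe b =>
        rw [toBdry_coe, toBdry_coe] at h
        exact h.not_swap (posOrder_coe_coe_infty.2 (EReal.coe_lt_coe_iff.1 hab))
  | coe c =>
    refine ⟨c, rfl, ?_⟩
    induction a using EReal.rec with
    | top => exact absurd hab not_top_lt
    | bot =>
      refine ⟨EReal.bot_lt_coe c, ?_⟩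
      induction b using EReal.rec with
      | bot => exact absurd hab (lt_irrefl _)
      | top => exact EReal.coe_lt_top c
      | coe b =>
        rw [toBdry_bot, toBdry_coe] at h
        exact EReal.coe_lt_coe_iff.2 (posOrder_coe_coe_infty.1 h.rotate)
    | coe a =>
      induction b using EReal.rec with
      | bot => exact absurd hab not_lt_bot
      | top =>
        rw [toBdry_top, toBdry_coe] at h
        exact ⟨EReal.coe_lt_coe_iff.2 (posOrder_coe_coe_infty.1 h), EReal.coe_lt_top c⟩
      | coe b =>
        rw [toBdry_coe, toBdry_coe] at h
        obtain ⟨h1, h2⟩ := (posOrder_coe_iff (EReal.coe_lt_coe_iff.1 hab)).1 h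
        exact ⟨EReal.coe_lt_coe_iff.2 h1, EReal.coe_lt_coe_iff.2 h2⟩

/-- The interval `(a, b)` of the extended real line is cut off by an edge of `T`. -/
def EdgeInterval (T : Set (Sym2 Bdry)) (a b : EReal) : Prop :=
  a < b ∧ s(toBdry a, toBdry b) ∈ T

/-- A rule which subdivides the extended real line along the triangles of `T`. -/
structure IsTriTree (T : Set (Sym2 Bdry)) (mid : EReal → EReal → EReal) : Prop where
  edge : Subdivides mid (EdgeInterval T)
  left : EdgeInterval T ⊥ (mid ⊥ ⊤)
  right : EdgeInterval T (mid ⊥ ⊤) ⊤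

lemma IsTriTree.all {T : Set (Sym2 Bdry)} {mid : EReal → EReal → EReal} (h : IsTriTree T mid) :
    Subdivides mid (fun a b => EdgeInterval T a b ∨ (a = ⊥ ∧ b = ⊤)) := by
  rintro a b (hab | ⟨rfl, rfl⟩)
  · obtain ⟨h1, h2, h3, h4⟩ := h.edge a b hab
    exact ⟨h1, h2, Or.inl h3, Or.inl h4⟩
  · exact ⟨h.left.1, h.right.1, Or.inl h.left, Or.inl h.right⟩

section
variable {S : Set (Sym2 Bdry)}

lemma not_infty_edge (h : s(OnePoint.infty, OnePoint.infty) ∈ flip farey S) : False := by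
  have := intDet_of_mem_flip h
  simp at this

open Classical in
lemma exists_isTriTree (hS : IsFlip farey S) : ∃ mid, IsTriTree (flip farey S) mid := by
  have h1 : ∀ a b : EReal, EdgeInterval (flip farey S) a b → ∃ c : EReal, a < c ∧ c < b ∧
      EdgeInterval (flip farey S) a c ∧ EdgeInterval (flip farey S) c b := by
    rintro a b ⟨hab, he⟩
    obtain ⟨z, hz, h1, h2⟩ := exists_flip_third hS he
    obtain ⟨c, rfl, hac, hcb⟩ := exists_real_of_posOrder hab hz
    rw [← toBdry_coe] at h1 h2
    exact ⟨c, hac, hcb, ⟨hac, h1⟩, ⟨hcb, h2⟩⟩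
  choose! m hm using h1
  obtain ⟨t, ht⟩ := exists_flip_edge_infty hS
  -- Both ends of the root interval are the point at infinity, so no edge cuts it off; it is split
  -- at a neighbour `t` of infinity instead.
  refine ⟨fun a b => if a = ⊥ ∧ b = ⊤ then (t : EReal) else m a b, ?_, ?_, ?_⟩
  · intro a b hab
    have : ¬ (a = ⊥ ∧ b = ⊤) := by
      rintro ⟨rfl, rfl⟩
      have := hab.2
      rw [toBdry_bot, toBdry_top] at this
      exact not_infty_edge this
    simp only [this, if_false]
    exact hm a b hab
  · simp only [and_self, if_true]
    refine ⟨EReal.bot_lt_coe t, ?_⟩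
    rwa [toBdry_bot, toBdry_coe, Sym2.eq_swap]
  · simp only [and_self, if_true]
    refine ⟨EReal.coe_lt_top t, ?_⟩
    rwa [toBdry_top, toBdry_coe]

variable {mid : EReal → EReal → EReal}

lemma EdgeInterval.not_all {a b : EReal} (h : EdgeInterval (flip farey S) a b) :
    ¬ (a = ⊥ ∧ b = ⊤) := by
  rintro ⟨rfl, rfl⟩
  have := h.2
  rw [toBdry_bot, toBdry_top] at this
  exact not_infty_edge this

lemma EdgeInterval.intDet {a b : EReal} (h : EdgeInterval (flip farey S) a b) :
    intDet (toBdry a) (toBdry b) = 1 ∨ intDet (toBdry a) (toBdry b) = 2 :=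
  intDet_of_mem_flip h.2

lemma EdgeInterval.den_ne_zero {a b : EReal} (h : EdgeInterval (flip farey S) a b) :
    den (toBdry a) ≠ 0 ∧ den (toBdry b) ≠ 0 := by
  have : IdealTri.intDet (toBdry a) (toBdry b) ≠ 0 := by
    rcases h.intDet with h | h <;> (rw [h]; norm_num)
  exact ⟨den_left_ne_zero this, den_right_ne_zero this⟩

/-- With denominators cleared: the quantity ax · xb / ab strictly decreases when the interval around
x shrinks from (a, b) to (a, c). It is the termination measure for locating x in the tree. -/
lemma intDet_measure_lt {a x c b : Bdry} (h1 : PosOrder a x c) (h2 : PosOrder a c b)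
    (ha : den a ≠ 0) (hb : den b ≠ 0) (hx : den x ≠ 0) (hc : den c ≠ 0) :
    intDet a x * intDet x c * intDet a b < intDet a x * intDet x b * intDet a c := by
  have hp := intDet_ptolemy h1 h2
  have e1 := one_le_intDet ha hx h1.ne
  have e2 := one_le_intDet hc hb h2.rotate.ne
  nlinarith [mul_pos (mul_pos (show 0 < intDet a x by linarith) (show 0 < intDet a x by linarith))
    (show 0 < intDet c b by linarith)]

/-- Every rational point of an interval of the tree is one of its subdivision points. -/
lemma exists_treePoint_eq (hT : IsTriTree (flip farey S) mid) (n : ℕ) :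
    ∀ a b x : EReal, EdgeInterval (flip farey S) a b → a < x → x < b → den (toBdry x) ≠ 0 →
      2 * (intDet (toBdry a) (toBdry x) * intDet (toBdry x) (toBdry b)) ≤
        n * intDet (toBdry a) (toBdry b) → ∃ w, x = treePoint mid a b w := by
  induction n with
  | zero =>
    intro a b x hab hax hxb hx hle
    exfalso
    have hp := posOrder_toBdry hax hxb hab.not_all
    have e1 := one_le_intDet hab.den_ne_zero.1 hx hp.ne
    have e2 := one_le_intDet hx hab.den_ne_zero.2 hp.rotate.ne
    simp only [Nat.cast_zero, zero_mul] at hle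
    nlinarith
  | succ n ih =>
    intro a b x hab hax hxb hx hle
    obtain ⟨h1, h2, h3, h4⟩ := hT.edge a b hab
    obtain ⟨ha, hb⟩ := hab.den_ne_zero
    have hc := h3.den_ne_zero.2
    have hpc := posOrder_toBdry h1 h2 hab.not_all
    have hab1 := one_le_intDet ha hb hpc.rotate.rotate.ne.symm
    -- Edges have determinant 1 or 2, so twice the measure is an integer and a strict decrease
    -- lowers it by at least 1.
    have step : ∀ p q : Bdry, (intDet p q = 1 ∨ intDet p q = 2) →
        intDet p (toBdry x) * intDet (toBdry x) q * intDet (toBdry a) (toBdry b) <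
        intDet (toBdry a) (toBdry x) * intDet (toBdry x) (toBdry b) * intDet p q →
        2 * (intDet p (toBdry x) * intDet (toBdry x) q) ≤ n * intDet p q := by
      intro p q hpq hlt
      obtain ⟨i, hi⟩ := exists_nat_intDet p (toBdry x)
      obtain ⟨j, hj⟩ := exists_nat_intDet (toBdry x) q
      rw [hi, hj] at hlt ⊢
      have hpq0 : 0 < intDet p q := by rcases hpq with h | h <;> rw [h] <;> norm_num
      have hlt2 : 2 * ((i : ℝ) * j) * intDet (toBdry a) (toBdry b) <
          ((n + 1 : ℕ) : ℝ) * intDet p q * intDet (toBdry a) (toBdry b) := by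
        nlinarith [mul_le_mul_of_nonneg_right hle hpq0.le]
      have hlt3 := lt_of_mul_lt_mul_right hlt2 (by linarith)
      rcases hpq with h | h
      · rw [h] at hlt3 ⊢
        have : 2 * (i * j) < (n + 1) * 1 := by exact_mod_cast hlt3
        have : 2 * (i * j) ≤ n * 1 := by omega
        exact_mod_cast this
      · rw [h] at hlt3 ⊢
        have : 2 * (i * j) < (n + 1) * 2 := by exact_mod_cast hlt3
        have : 2 * (i * j) ≤ n * 2 := by omega
        exact_mod_cast this
    rcases lt_trichotomy x (mid a b) with hlt | rfl | hlt
    · obtain ⟨w, hw⟩ := ih a (mid a b) x h3 hax hlt hx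
        (step _ _ h3.intDet (intDet_measure_lt (posOrder_toBdry hax hlt h3.not_all) hpc ha hb hx hc))
      exact ⟨false :: w, hw⟩
    · exact ⟨[], rfl⟩
    · have hpx := posOrder_toBdry hlt hxb h4.not_all
      have hax' := posOrder_toBdry hax hxb hab.not_all
      have hm := intDet_ptolemy hpx hpc.rotate
      have e1 := one_le_intDet hx hb hpx.rotate.ne
      have e2 := one_le_intDet ha hc hpc.ne
      obtain ⟨w, hw⟩ := ih (mid a b) b x h4 hlt hxb hx (step _ _ h4.intDet (by
        rw [intDet_comm (toBdry x) (toBdry a), intDet_comm (toBdry b) (toBdry a),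
          intDet_comm (toBdry (mid a b)) (toBdry a)] at hm
        have e3 : 0 < intDet (toBdry x) (toBdry b) * intDet (toBdry x) (toBdry b) *
          intDet (toBdry a) (toBdry (mid a b)) := by positivity
        nlinarith))
      exact ⟨true :: w, hw⟩

lemma exists_treePoint_of_rational (hT : IsTriTree (flip farey S) mid) {a b x : EReal}
    (hab : EdgeInterval (flip farey S) a b) (hax : a < x) (hxb : x < b)
    (hx : den (toBdry x) ≠ 0) : ∃ w, x = treePoint mid a b w := by
  obtain ⟨n, hn⟩ := exists_nat_ge
    (2 * (intDet (toBdry a) (toBdry x) * intDet (toBdry x) (toBdry b)))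
  refine exists_treePoint_eq hT n a b x hab hax hxb hx (hn.trans ?_)
  refine le_mul_of_one_le_right (Nat.cast_nonneg n) ?_
  rcases hab.intDet with h | h
  · exact h.ge
  · rw [h]; norm_num

lemma treePoint_surjective (hT : IsTriTree (flip farey S) mid) (q : ℚ) :
    ∃ w, ((q : ℝ) : EReal) = treePoint mid ⊥ ⊤ w := by
  have hq : den (toBdry ((q : ℝ) : EReal)) ≠ 0 := by
    rw [toBdry_coe, den_ratCast]; exact q.den_nz
  rcases lt_trichotomy ((q : ℝ) : EReal) (mid ⊥ ⊤) with h | h | h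
  · obtain ⟨w, hw⟩ := exists_treePoint_of_rational hT hT.left (EReal.bot_lt_coe _) h hq
    exact ⟨false :: w, hw⟩
  · exact ⟨[], h⟩
  · obtain ⟨w, hw⟩ := exists_treePoint_of_rational hT hT.right h (EReal.coe_lt_top _) hq
    exact ⟨true :: w, hw⟩

lemma exists_rat_eq {x : EReal} (h1 : x ≠ ⊥) (h2 : x ≠ ⊤) (hx : den (toBdry x) ≠ 0) :
    ∃ q : ℚ, x = ((q : ℝ) : EReal) := by
  induction x using EReal.rec with
  | bot => exact absurd rfl h1
  | top => exact absurd rfl h2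
  | coe x =>
    rw [toBdry_coe] at hx
    obtain ⟨r, rfl⟩ := exists_rat_of_den_ne_zero hx
    exact ⟨r, rfl⟩

lemma treePoint_den_ne_zero (hT : IsTriTree (flip farey S) mid) (w : List Bool) :
    ∀ a b, (EdgeInterval (flip farey S) a b ∨ (a = ⊥ ∧ b = ⊤)) →
      den (toBdry (treePoint mid a b w)) ≠ 0 := by
  induction w with
  | nil =>
    rintro a b (h | ⟨rfl, rfl⟩)
    · exact (hT.edge a b h).2.2.1.den_ne_zero.2
    · exact hT.left.den_ne_zero.2
  | cons d w ih =>
    intro a b hab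
    obtain ⟨-, -, h3, h4⟩ := hT.all a b hab
    cases d
    · exact ih _ _ h3
    · exact ih _ _ h4

lemma treePoint_rational (hT : IsTriTree (flip farey S) mid) (w : List Bool) :
    ∃ q : ℚ, treePoint mid ⊥ ⊤ w = ((q : ℝ) : EReal) := by
  have h := treePoint_mem hT.all w ⊥ ⊤ (Or.inr ⟨rfl, rfl⟩)
  exact exists_rat_eq h.1.ne' h.2.ne (treePoint_den_ne_zero hT w ⊥ ⊤ (Or.inr ⟨rfl, rfl⟩))

/-- The homeomorphism of the extended real line which matches the subdivision points of two
trees. -/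
lemma exists_matching {S' : Set (Sym2 Bdry)} {mid' : EReal → EReal → EReal}
    (hT : IsTriTree (flip farey S) mid) (hT' : IsTriTree (flip farey S') mid') :
    ∃ g : ℝ ≃o ℝ, ∀ (w : List Bool) (q : ℝ), treePoint mid ⊥ ⊤ w = (q : EReal) →
      treePoint mid' ⊥ ⊤ w = (g q : EReal) := by
  choose w hw using treePoint_surjective hT
  choose r hr using treePoint_rational hT'
  have hroot : ∀ {T : Set (Sym2 Bdry)}, EdgeInterval T ⊥ ⊤ ∨ ((⊥ : EReal) = ⊥ ∧ (⊤ : EReal) = ⊤) :=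
    Or.inr ⟨rfl, rfl⟩
  have hcast : ∀ {p q : ℚ}, ((p : ℝ) : EReal) < ((q : ℝ) : EReal) ↔ p < q := by
    intro p q
    rw [EReal.coe_lt_coe_iff, Rat.cast_lt]
  have hmono : StrictMono fun q => r (w q) := by
    intro p q hpq
    rw [← hcast, hw p, hw q] at hpq
    have := treePoint_lt hT.all hT'.all _ _ ⊥ ⊤ ⊥ ⊤ hroot hroot hpq
    rwa [hr, hr, hcast] at this
  -- The chosen address of a rational need not be known to be unique; the order comparison shows
  -- that the choice does not matter.
  have hinj : ∀ v v', treePoint mid ⊥ ⊤ v = treePoint mid ⊥ ⊤ v' →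
      treePoint mid' ⊥ ⊤ v = treePoint mid' ⊥ ⊤ v' := by
    intro v v' h
    by_contra hne
    rcases lt_or_gt_of_ne hne with hlt | hlt
    · exact (treePoint_lt hT'.all hT.all _ _ ⊥ ⊤ ⊥ ⊤ hroot hroot hlt).ne h
    · exact (treePoint_lt hT'.all hT.all _ _ ⊥ ⊤ ⊥ ⊤ hroot hroot hlt).ne h.symm
  have hsurj : Function.Surjective fun q => r (w q) := by
    intro s
    obtain ⟨v, hv⟩ := treePoint_surjective hT' s
    obtain ⟨q, hq⟩ := treePoint_rational hT v
    refine ⟨q, ?_⟩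
    have h1 := hinj v (w q) (hq.trans (hw q))
    rw [hr (w q), ← hv, EReal.coe_eq_coe_iff, Rat.cast_inj] at h1
    exact h1.symm
  obtain ⟨g, hg⟩ := exists_orderIso_extending hmono hsurj
  refine ⟨g, fun v x hx => ?_⟩
  obtain ⟨q, hq⟩ := treePoint_rational hT v
  have hxq : x = q := EReal.coe_eq_coe_iff.1 (hx.symm.trans hq)
  rw [hxq, hg, hinj v (w q) (hq.trans (hw q)), hr]

end

/-! ### Transfer of edges and the characteristic map. -/

/-- The extension of an increasing bijection of the reals by `⊥ ↦ ⊥` and `⊤ ↦ ⊤`. -/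
noncomputable def extendEReal (g : ℝ ≃o ℝ) (x : EReal) : EReal :=
  if x = ⊥ then ⊥ else if x = ⊤ then ⊤ else (g x.toReal : EReal)

@[simp] lemma extendEReal_bot (g : ℝ ≃o ℝ) : extendEReal g ⊥ = ⊥ := by simp [extendEReal]
@[simp] lemma extendEReal_top (g : ℝ ≃o ℝ) : extendEReal g ⊤ = ⊤ := by simp [extendEReal]
@[simp] lemma extendEReal_coe (g : ℝ ≃o ℝ) (x : ℝ) : extendEReal g x = (g x : EReal) := by
  simp [extendEReal]

/-- The homeomorphism of the circle which fixes infinity and restricts to `g`. -/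
def bdryMap (g : ℝ ≃o ℝ) : Bdry ≃ₜ Bdry := g.toHomeomorph.onePointCongr

@[simp] lemma bdryMap_infty (g : ℝ ≃o ℝ) : bdryMap g OnePoint.infty = OnePoint.infty := rfl
@[simp] lemma bdryMap_coe (g : ℝ ≃o ℝ) (x : ℝ) : bdryMap g (x : Bdry) = (g x : Bdry) := rfl

lemma toBdry_extendEReal (g : ℝ ≃o ℝ) (x : EReal) :
    toBdry (extendEReal g x) = bdryMap g (toBdry x) := by
  induction x using EReal.rec <;> simp

lemma angle_bdryMap_lt (g : ℝ ≃o ℝ) {a b : Bdry} (h : angle a < angle b) :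
    angle (bdryMap g a) < angle (bdryMap g b) := by
  induction a using OnePoint.rec with
  | infty => exact absurd h (angle_le_pi b).not_gt
  | coe a =>
    induction b using OnePoint.rec with
    | infty => exact angle_coe_lt_pi _
    | coe b => exact angle_coe_lt_coe.2 (g.strictMono (angle_coe_lt_coe.1 h))

lemma cyclicMono_bdryMap (g : ℝ ≃o ℝ) : CyclicMono (bdryMap g) := by
  rintro a b c (⟨h1, h2⟩ | ⟨h1, h2⟩ | ⟨h1, h2⟩)
  · exact Or.inl ⟨angle_bdryMap_lt g h1, angle_bdryMap_lt g h2⟩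
  · exact Or.inr (Or.inl ⟨angle_bdryMap_lt g h1, angle_bdryMap_lt g h2⟩)
  · exact Or.inr (Or.inr ⟨angle_bdryMap_lt g h1, angle_bdryMap_lt g h2⟩)

/-- The geodesic from `x` to `y` crosses no edge of `T`. -/
def NotCrossed (T : Set (Sym2 Bdry)) (x y : Bdry) : Prop :=
  ∀ b d, PosOrder x b y → PosOrder x y d → s(b, d) ∉ T

lemma NotCrossed.symm {T : Set (Sym2 Bdry)} {x y : Bdry} (h : NotCrossed T x y) :
    NotCrossed T y x := by
  intro b d h1 h2
  rw [Sym2.eq_swap]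
  exact h d b h2.rotate h1.rotate.rotate

section
variable {S S' : Set (Sym2 Bdry)} {mid mid' : EReal → EReal → EReal}

/-- The endpoints of the edge are nodes or ends of the tree, so the edge either is one of the tree's
intervals, which `e` matches with an interval of the other tree, or crosses one, which `hnc`
forbids. -/
lemma edge_transfer_aux (hT : IsTriTree (flip farey S) mid) (hT' : IsTriTree (flip farey S') mid')
    (e : EReal → EReal) {a b x y : EReal} (hab : EdgeInterval (flip farey S) a b)
    (hab' : EdgeInterval (flip farey S') (e a) (e b))
    (he : ∀ w, e (treePoint mid a b w) = treePoint mid' (e a) (e b) w)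
    (hxy : EdgeInterval (flip farey S) x y) (hax : a ≤ x) (hyb : y ≤ b)
    (hnc : NotCrossed (flip farey S) (toBdry x) (toBdry y)) :
    EdgeInterval (flip farey S') (e x) (e y) := by
  have hx : x = a ∨ x = b ∨ ∃ w, x = treePoint mid a b w := by
    rcases hax.eq_or_lt with rfl | hax
    · exact Or.inl rfl
    · exact Or.inr (Or.inr (exists_treePoint_of_rational hT hab hax (hxy.1.trans_le hyb)
        hxy.den_ne_zero.1))
  have hy : y = a ∨ y = b ∨ ∃ w, y = treePoint mid a b w := by
    rcases hyb.eq_or_lt with rfl | hyb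
    · exact Or.inr (Or.inl rfl)
    · exact Or.inr (Or.inr (exists_treePoint_of_rational hT hab (hax.trans_lt hxy.1) hyb
        hxy.den_ne_zero.2))
  have hbound : ∃ n, (x = a ∨ x = b ∨ ∃ w : List Bool, w.length < n ∧ x = treePoint mid a b w) ∧
      (y = a ∨ y = b ∨ ∃ w : List Bool, w.length < n ∧ y = treePoint mid a b w) := by
    have key : ∀ z, (z = a ∨ z = b ∨ ∃ w, z = treePoint mid a b w) → ∃ n, ∀ m, n ≤ m →
        (z = a ∨ z = b ∨ ∃ w : List Bool, w.length < m ∧ z = treePoint mid a b w) := by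
      rintro z (h | h | ⟨w, h⟩)
      · exact ⟨0, fun m _ => Or.inl h⟩
      · exact ⟨0, fun m _ => Or.inr (Or.inl h)⟩
      · exact ⟨w.length + 1, fun m hm => Or.inr (Or.inr ⟨w, hm, h⟩)⟩
    obtain ⟨n1, h1⟩ := key x hx
    obtain ⟨n2, h2⟩ := key y hy
    exact ⟨max n1 n2, h1 _ (le_max_left _ _), h2 _ (le_max_right _ _)⟩
  obtain ⟨n, hx, hy⟩ := hbound
  rcases descends_or_cross hT.edge n a b x y hab hxy.1 hx hy with hd | ⟨p, q, hd, hc⟩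
  · exact hd.map_good hT'.edge hab' he
  · exfalso
    obtain ⟨hpq, hap, hqb⟩ := hd.good hT.edge hab
    have hna : ∀ {u v : EReal}, a ≤ u → v ≤ b → ¬ (u = ⊥ ∧ v = ⊤) := by
      rintro u v hu hv ⟨rfl, rfl⟩
      exact hab.not_all ⟨le_bot_iff.1 hu, top_le_iff.1 hv⟩
    rcases hc with ⟨h1, h2, h3⟩ | ⟨h1, h2, h3⟩
    · exact hnc _ _ (posOrder_toBdry h1 h2 (hna hax hyb))
        (posOrder_toBdry (h1.trans h2) h3 (hna hax hqb)) hpq.2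
    · refine hnc _ _ (posOrder_toBdry h2 h3 (hna hax hyb))
        (posOrder_toBdry h1 (h2.trans h3) (hna hap hyb)).rotate ?_
      rw [Sym2.eq_swap]
      exact hpq.2

lemma edge_transfer (hT : IsTriTree (flip farey S) mid) (hT' : IsTriTree (flip farey S') mid')
    {g : ℝ ≃o ℝ} (hg : ∀ (w : List Bool) (q : ℝ), treePoint mid ⊥ ⊤ w = (q : EReal) →
      treePoint mid' ⊥ ⊤ w = (g q : EReal)) {x y : Bdry} (hxy : s(x, y) ∈ flip farey S)
    (hnc : NotCrossed (flip farey S) x y) :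
    s(bdryMap g x, bdryMap g y) ∈ flip farey S' := by
  have he : ∀ w, extendEReal g (treePoint mid ⊥ ⊤ w) = treePoint mid' ⊥ ⊤ w := by
    intro w
    obtain ⟨q, hq⟩ := treePoint_rational hT w
    rw [hg w q hq, hq, extendEReal_coe]
  have hm : extendEReal g (mid ⊥ ⊤) = mid' ⊥ ⊤ := he []
  have hlow : ∀ u v : EReal, EdgeInterval (flip farey S) u v → v ≤ mid ⊥ ⊤ →
      NotCrossed (flip farey S) (toBdry u) (toBdry v) →
      s(bdryMap g (toBdry u), bdryMap g (toBdry v)) ∈ flip farey S' := by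
    intro u v huv hv hnc
    rw [← toBdry_extendEReal, ← toBdry_extendEReal]
    refine (edge_transfer_aux hT hT' (extendEReal g) hT.left ?_ ?_ huv bot_le hv hnc).2
    · rw [hm, extendEReal_bot]; exact hT'.left
    · intro w
      rw [hm, extendEReal_bot]
      exact he (false :: w)
  have hhigh : ∀ u v : EReal, EdgeInterval (flip farey S) u v → mid ⊥ ⊤ ≤ u →
      NotCrossed (flip farey S) (toBdry u) (toBdry v) →
      s(bdryMap g (toBdry u), bdryMap g (toBdry v)) ∈ flip farey S' := by
    intro u v huv hu hnc
    rw [← toBdry_extendEReal, ← toBdry_extendEReal]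
    refine (edge_transfer_aux hT hT' (extendEReal g) hT.right ?_ ?_ huv hu le_top hnc).2
    · rw [hm, extendEReal_top]; exact hT'.right
    · intro w
      rw [hm, extendEReal_top]
      exact he (true :: w)
  have hinf : ∀ t : ℝ, s((t : Bdry), OnePoint.infty) ∈ flip farey S →
      NotCrossed (flip farey S) (t : Bdry) OnePoint.infty →
      s(bdryMap g (t : Bdry), bdryMap g OnePoint.infty) ∈ flip farey S' := by
    intro t ht hnc
    rcases le_total (t : EReal) (mid ⊥ ⊤) with h | h
    · rw [Sym2.eq_swap]
      simpa only [toBdry_bot, toBdry_coe] using hlow ⊥ t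
        ⟨EReal.bot_lt_coe t, by rwa [toBdry_bot, toBdry_coe, Sym2.eq_swap]⟩ h
        (by rw [toBdry_bot, toBdry_coe]; exact hnc.symm)
    · simpa only [toBdry_top, toBdry_coe] using hhigh t ⊤
        ⟨EReal.coe_lt_top t, by rwa [toBdry_top, toBdry_coe]⟩ h
        (by rw [toBdry_top, toBdry_coe]; exact hnc)
  have hreal : ∀ u v : ℝ, u < v → s((u : Bdry), (v : Bdry)) ∈ flip farey S →
      NotCrossed (flip farey S) (u : Bdry) (v : Bdry) →
      s(bdryMap g (u : Bdry), bdryMap g (v : Bdry)) ∈ flip farey S' := by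
    intro u v huv hm hnc
    have hE : EdgeInterval (flip farey S) u v :=
      ⟨EReal.coe_lt_coe_iff.2 huv, by rwa [toBdry_coe, toBdry_coe]⟩
    rcases le_or_gt (v : EReal) (mid ⊥ ⊤) with h | h
    · simpa only [toBdry_coe] using hlow u v hE h (by rwa [toBdry_coe, toBdry_coe])
    rcases le_or_gt (mid ⊥ ⊤) (u : EReal) with h' | h'
    · simpa only [toBdry_coe] using hhigh u v hE h' (by rwa [toBdry_coe, toBdry_coe])
    exfalso
    -- An edge straddling the root point would cross the edge from that point to infinity.
    have p1 := posOrder_toBdry h' h (fun hc => EReal.coe_ne_bot u hc.1)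
    have p2 : PosOrder (u : Bdry) (v : Bdry) (toBdry ⊤) := by
      rw [toBdry_top]; exact posOrder_coe_coe_infty.2 huv
    rw [toBdry_coe, toBdry_coe] at p1
    exact hnc _ _ p1 p2 hT.right.2
  induction x using OnePoint.rec with
  | infty =>
    induction y using OnePoint.rec with
    | infty => exact (not_infty_edge hxy).elim
    | coe v =>
      rw [Sym2.eq_swap] at hxy ⊢
      exact hinf v hxy hnc.symm
  | coe u =>
    induction y using OnePoint.rec with
    | infty => exact hinf u hxy hnc
    | coe v =>
      rcases lt_trichotomy u v with h | h | h
      · exact hreal u v h hxy hnc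
      · subst h
        have := intDet_of_mem_flip hxy
        simp at this
      · rw [Sym2.eq_swap] at hxy ⊢
        exact hreal v u h hxy hnc.symm

lemma notCrossed_of_unflipped {x y : Bdry} (h : intDet x y = 1) (hS : s(x, y) ∉ S) :
    NotCrossed (flip farey S) x y :=
  fun _ _ h1 h2 => unflipped_not_cross h1 h2 h hS

/-- A flip of the Farey triangulation has a characteristic map. -/
theorem exists_characteristicMap_flip_farey (hS : IsFlip farey S) :
    ∃ g : Bdry ≃ₜ Bdry, IsCharacteristicMap g (flip farey S) := by
  obtain ⟨mid, hT⟩ := exists_isTriTree (isFlip_empty farey)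
  obtain ⟨mid', hT'⟩ := exists_isTriTree hS
  obtain ⟨g, hg⟩ := exists_matching hT hT'
  have hg' : ∀ (w : List Bool) (q : ℝ), treePoint mid' ⊥ ⊤ w = (q : EReal) →
      treePoint mid ⊥ ⊤ w = (g.symm q : EReal) := by
    intro w q hq
    obtain ⟨p, hp⟩ := treePoint_rational hT w
    have := hg w p hp
    rw [hq, EReal.coe_eq_coe_iff] at this
    rw [hp, this, OrderIso.symm_apply_apply]
  have hsymm : ∀ x, bdryMap g.symm (bdryMap g x) = x := by
    intro x
    induction x using OnePoint.rec <;> simp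
  have hsymm' : ∀ x, bdryMap g (bdryMap g.symm x) = x := by
    intro x
    induction x using OnePoint.rec <;> simp
  have hsub : ∀ x y, intDet x y = 1 → s(bdryMap g x, bdryMap g y) ∈ flip farey S := by
    intro x y hxy
    refine edge_transfer hT hT' hg ?_ (notCrossed_of_unflipped hxy (Set.notMem_empty _))
    rw [flip_empty]
    exact mem_farey.2 hxy
  -- Only kept edges are pulled back directly, since for them the absence of crossings is known. New
  -- diagonals are recovered from their quadrilaterals below.
  have hkeep : ∀ x y, intDet x y = 1 → s(x, y) ∉ S →
      intDet (bdryMap g.symm x) (bdryMap g.symm y) = 1 := by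
    intro x y hxy hxyS
    have := edge_transfer hT' hT hg' (mem_flip.2 (Or.inl ⟨mem_farey.2 hxy, hxyS⟩))
      (notCrossed_of_unflipped hxy hxyS)
    rw [flip_empty] at this
    exact mem_farey.1 this
  refine ⟨bdryMap g, cyclicMono_bdryMap g, ?_⟩
  ext e
  induction e using Sym2.ind with
  | _ x y =>
    have hmem : s(x, y) ∈ mapTri (bdryMap g) farey ↔
        intDet (bdryMap g.symm x) (bdryMap g.symm y) = 1 := by
      rw [mem_mapTri, mem_farey]
      rfl
    rw [hmem]
    constructor
    · intro h
      have := hsub _ _ h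
      rwa [hsymm', hsymm'] at this
    · intro h
      rcases mem_flip.1 h with ⟨h1, h2⟩ | ⟨a, c, hac, hq⟩
      · exact hkeep x y (mem_farey.1 h1) h2
      · have hac' : s(c, a) ∈ S := by rwa [Sym2.eq_swap]
        obtain ⟨q1, q2, t1, t2⟩ := hq
        obtain ⟨e1, e2, e3⟩ := isTriangle_farey.1 t1
        obtain ⟨-, e4, e5⟩ := isTriangle_farey.1 t2
        have e1' := intDet_comm a x ▸ e1
        have e3' := intDet_comm a c ▸ e3
        have e4' := intDet_comm c y ▸ e4
        have e5' := intDet_comm a y ▸ e5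
        -- The four sides of the quadrilateral are kept, so their preimages have determinant 1, and
        -- Ptolemy's identity gives product 2 for the preimages of the diagonals.
        have k1 := hkeep x a e1' (hS.left_notMem (isTriangle_farey.2 ⟨e1', e3, e2⟩) hac)
        have k2 := hkeep x c e2 (hS.left_notMem (isTriangle_farey.2 ⟨e2, e3', e1'⟩) hac')
        have k3 := hkeep y c e4' (hS.left_notMem (isTriangle_farey.2 ⟨e4', e3', e5'⟩) hac')
        have k4 := hkeep y a e5' (hS.left_notMem (isTriangle_farey.2 ⟨e5', e3, e4'⟩) hac)
        have p1 := cyclicMono_bdryMap g.symm _ _ _ q1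
        have p2 := cyclicMono_bdryMap g.symm _ _ _ q2
        have hp := intDet_ptolemy p1 p2
        rw [intDet_comm (bdryMap g.symm a) (bdryMap g.symm x), k1, k2,
          intDet_comm (bdryMap g.symm c) (bdryMap g.symm y), k3,
          intDet_comm (bdryMap g.symm a) (bdryMap g.symm y), k4] at hp
        obtain ⟨i, hi⟩ := exists_nat_intDet (bdryMap g.symm a) (bdryMap g.symm c)
        obtain ⟨j, hj⟩ := exists_nat_intDet (bdryMap g.symm x) (bdryMap g.symm y)
        -- If the preimage of ac were a Farey edge, ac would belong to the flipped triangulation;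
        -- but it was removed, and its determinant 1 is not that of a new diagonal. So i = 2 and j =
        -- 1.
        have hi1 : i ≠ 1 := by
          rintro rfl
          rw [Nat.cast_one] at hi
          have := hsub _ _ hi
          rw [hsymm', hsymm'] at this
          rcases mem_flip.1 this with ⟨-, h'⟩ | ⟨_, _, -, hq'⟩
          · exact h' hac
          · have := hq'.intDet_diagonal
            rw [e3] at this
            norm_num at this
        rw [hi, hj] at hp
        have hij : i * j = 2 := by
          have : (i : ℝ) * j = 2 := by linarith
          exact_mod_cast this
        have hi2 : i ∣ 2 := ⟨j, hij.symm⟩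
        have hi3 : i = 2 := ((Nat.dvd_prime Nat.prime_two).1 hi2).resolve_left hi1
        rw [hi3] at hij
        have : j = 1 := by omega
        rw [hj, this, Nat.cast_one]

end

/-! ### Conclusion: reduction to flips of the Farey triangulation. -/

lemma fareyBounded_of_isCharacteristicMap {S : Set (Sym2 Bdry)} {f : Bdry ≃ₜ Bdry}
    (hf : IsCharacteristicMap f (flip farey S)) : FareyBounded 2 f where
  mono := hf.1
  bound x y h := by
    have : s(f x, f y) ∈ mapTri f farey := mem_mapTri.2 (by simpa using mem_farey.2 h)
    rw [hf.2] at this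
    rcases intDet_of_mem_flip this with h | h <;> rw [h] <;> norm_num

lemma mapTri_trans (f g : Bdry ≃ₜ Bdry) (T : Set (Sym2 Bdry)) :
    mapTri (f.trans g) T = mapTri g (mapTri f T) := by
  ext e
  induction e using Sym2.ind with
  | _ x y => simp [mem_mapTri]

end IdealTri

theorem proposition4p3 (h : IdealTri.Bdry ≃ₜ IdealTri.Bdry)
    (hh : IdealTri.Quasisymmetric h)
    (S : Set (Sym2 IdealTri.Bdry))
    (hS : IdealTri.IsFlip (IdealTri.mapTri h IdealTri.farey) S) :
    (∃ g : IdealTri.Bdry ≃ₜ IdealTri.Bdry,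
      IdealTri.IsCharacteristicMap g
        (IdealTri.flip (IdealTri.mapTri h IdealTri.farey) S)) ∧
    ∀ g : IdealTri.Bdry ≃ₜ IdealTri.Bdry,
      IdealTri.IsCharacteristicMap g
        (IdealTri.flip (IdealTri.mapTri h IdealTri.farey) S) →
      IdealTri.Quasisymmetric g := by
  have hm : IdealTri.CyclicMono h := hh.1
  obtain ⟨R, rfl⟩ : ∃ R, S = IdealTri.mapTri h R :=
    ⟨_, (IdealTri.mapTri_mapTri_symm h S).symm⟩
  have hR := IdealTri.IsFlip.of_mapTri hm hS
  rw [IdealTri.flip_mapTri hm]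
  constructor
  · obtain ⟨g, hg1, hg2⟩ := IdealTri.exists_characteristicMap_flip_farey hR
    refine ⟨g.trans h, fun a b c habc => hm _ _ _ (hg1 _ _ _ habc), ?_⟩
    rw [IdealTri.mapTri_trans, hg2]
  · rintro g ⟨hg1, hg2⟩
    have hf : IdealTri.IsCharacteristicMap (g.trans h.symm)
        (IdealTri.flip IdealTri.farey R) := by
      refine ⟨fun a b c habc => hm.symm _ _ _ (hg1 _ _ _ habc), ?_⟩
      rw [IdealTri.mapTri_trans, hg2]
      exact IdealTri.mapTri_mapTri_symm h.symm _
    -- Here g = h ∘ (h⁻¹ ∘ g) with a Farey-bounded inner factor, so quasisymmetry of h⁻¹ is not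
    -- needed.
    have hq := (IdealTri.fareyBounded_of_isCharacteristicMap hf).quasisymmetric.trans hh
    have : (g.trans h.symm).trans h = g := by
      ext x
      simp
    rwa [this] at hq
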